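/- **Setting.** A network has $M$ base stations (BSs) with $N_{\mathrm t}$ antennas, each serving $K$ users, and $N$ target monitoring terminals. Given are channels $\mathbf h_{i,m,k}\in\mathbb C^{N_{\mathrm t}}$ (from BS $i$ to user $(m,k)$), steering vectors $\mathbf a(\theta_m)\in\mathbb C^{N_{\mathrm t}}$, a matrix $\boldsymbol\Lambda\in\mathbb R^{2\times MN}$, path coefficients $\varepsilon_{m,n}\in\mathbb C$, real constants $T,\beta,\sigma_{\mathrm s},P$ and $\sigma_{\mathrm n}>0$, and a threshold $\epsilon\in\mathbb R$. For beamformers $\mathbf f=\{\mathbf f_{m,k}\}\subset\mathbb C^{N_{\mathrm t}}$ put $$\omega_{m,k}(\mathbf f)=\sum_{(i,j)\ne(m,k)}|\mathbf h_{i,m,k}^H\mathbf f_{i,j}|^2,\qquad \mathrm{SINR}_{m,k}(\mathbf f)=\frac{|\mathbf h_{m,m,k}^H\mathbf f_{m,k}|^2}{\omega_{m,k}(\mathbf f)+\sigma_{\mathrm n}^2},\qquad d_m(\mathbf f)=\sum_{k}|\mathbf a^T(\theta_m)\mathbf f_{m,k}|^2 .$$ For $q\in\mathbb R^M$ let $\mathbf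 J(q)=\boldsymbol\Lambda\,\mathrm{diag}(q_1\hat{\mathbf Z}_1,\dots,q_M\hat{\mathbf Z}_M)\boldsymbol\Lambda^T$ with $\hat{\mathbf Z}_m=\frac{8\pi^2T\beta^2}{\sigma_{\mathrm s}^2}\mathrm{diag}(|\varepsilon_{m,1}|^2,\dots,|\varepsilon_{m,N}|^2)$, and $C(q)=\mathrm{tr}(\mathbf J(q)^{-1})$; the constraint $C(q)\le\epsilon$ includes the requirement $\mathbf J(q)\succ0$. The *communication-centric problem* is $$\max_{\mathbf f}\ \min_{m,k}\mathrm{SINR}_{m,k}(\mathbf f)\quad\text{s.t.}\quad \sum_k\|\mathbf f_{m,k}\|^2\le P\ \ \forall m,\qquad C(d(\mathbf f))\le\epsilon .\tag{1}$$ A point $\mathbf f$ is a *KKT point* of (1), resp. is *regular*, if at $(\mathbf f,t)$ with $t=\min_{m,k}\mathrm{SINR}_{m,k}(\mathbf f)$ the KKT conditions, resp. the Mangasarian–Fromovitz constraint qualification, hold for the equivalent smooth problem: maximize $t$ over $(\mathbf f,t)$ subject to $t\le\mathrm{SINR}_{m,k}(\mathbf f)$ for all $m,k$ and the constraints of (1).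 **Algorithm.** Start from $(\mathbf f^{(0)},\rho^{(0)},u^{(0)})$ with $\mathbf f^{(0)}$ feasible for (1), $(\rho^{(0)}_{m,k})^2\le|\mathbf h_{m,m,k}^H\mathbf f^{(0)}_{m,k}|^2$, $\rho^{(0)}_{m,k}\neq0$ and $u^{(0)}_{m,k}\ge\sigma_{\mathrm n}^2+\omega_{m,k}(\mathbf f^{(0)})$ for all $m,k$. Given $(\mathbf f^{(r)},\rho^{(r)},u^{(r)})$, let $(\mathbf f^{(r+1)},\rho^{(r+1)},u^{(r+1)},q,\varpi^{(r+1)})$ be any optimal solution of the convex problem of maximizing $\varpi$ over $(\mathbf f,\rho,u,q,\varpi)$ subject to, for all $m,k$, $$\sum_k\|\mathbf f_{m,k}\|^2\le P,\qquad C(q)\le\epsilon,\qquad \sigma_{\mathrm n}^2+\omega_{m,k}(\mathbf f)\le u_{m,k},$$ $$q_m\le 2\,\mathrm{Re}\sum_k \mathbf f_{m,k}^H\mathbf a^*(\theta_m)\mathbf a^T(\theta_m)\mathbf f^{(r)}_{m,k}-d_m(\mathbf f^{(r)}),$$ $$\rho_{m,k}^2\le2\,\mathrm{Re}\big(\mathbf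 f_{m,k}^H\mathbf h_{m,m,k}\mathbf h_{m,m,k}^H\mathbf f^{(r)}_{m,k}\big)-|\mathbf h_{m,m,k}^H\mathbf f^{(r)}_{m,k}|^2,$$ $$\varpi\le\frac{2\rho^{(r)}_{m,k}}{u^{(r)}_{m,k}}\rho_{m,k}-\frac{(\rho^{(r)}_{m,k})^2}{(u^{(r)}_{m,k})^2}u_{m,k}.$$ **Corollary 3.** From every such initial point the algorithm can be run (each convex problem has an optimal solution), and the following holds for every run. 1. The values $\varpi^{(r)}$ are nondecreasing and converge to some $L\in\mathbb R$, and the sequence $(\mathbf f^{(r)})$ is bounded, so it has accumulation points. 2. Every regular accumulation point $\mathbf f^\star$ of $(\mathbf f^{(r)})$ is a KKT point of (1), and $\min_{m,k}\mathrm{SINR}_{m,k}(\mathbf f^\star)=L$. 3. If all accumulation points of $(\mathbf f^{(r)})$ are regular, then the distance from $\mathbf f^{(r)}$ to the set of KKT points of (1) tends to $0$. Moreover, with the other data fixed, for all but finitely many thresholds $\epsilon$ every feasible point of (1) is regular, so that the regularity conditions in 2 and 3 hold automatically. -/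

import Mathlib

open Filter Topology

noncomputable section

/-! ### Smooth constrained maximization: KKT points and the Mangasarian–Fromovitz condition -/

/-- The problem: maximize `obj x` subject to `con j x ≤ 0` for all `j`, where `x` ranges over
the domain `dom` of the functions involved. -/
structure MaxProblem (E : Type*) (κ : Type*) where
  dom : Set E
  obj : E → ℝ
  con : κ → E → ℝ

namespace MaxProblem

variable {E κ : Type*} [NormedAddCommGroup E] [NormedSpace ℝ E] [Fintype κ]

/-- `x` lies in the domain and satisfies all constraints. -/
def Feasible (Q : MaxProblem E κ) (x : E) : Prop :=
  x ∈ Q.dom ∧ ∀ j, Q.con j x ≤ 0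

/-- Karush–Kuhn–Tucker points: primal feasibility, and multipliers with dual feasibility,
complementary slackness and stationarity (the functions being differentiable at `x`). -/
def IsKKT (Q : MaxProblem E κ) (x : E) : Prop :=
  Q.Feasible x ∧ DifferentiableAt ℝ Q.obj x ∧ (∀ j, DifferentiableAt ℝ (Q.con j) x) ∧
    ∃ mult : κ → ℝ, (∀ j, 0 ≤ mult j) ∧ (∀ j, mult j * Q.con j x = 0) ∧
      fderiv ℝ Q.obj x = ∑ j, mult j • fderiv ℝ (Q.con j) x

/-- The Mangasarian–Fromovitz constraint qualification at `x`: some direction strictly decreases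
all active constraints to first order. -/
def MFCQ (Q : MaxProblem E κ) (x : E) : Prop :=
  ∃ d : E, ∀ j, Q.con j x = 0 → fderiv ℝ (Q.con j) x d < 0

end MaxProblem

/-! ### The network -/

/-- Beamformers `f m k ∈ ℂ^Nt`, for base station `m` and its user `k`. -/
abbrev Beams (M K Nt : ℕ) : Type := Fin M → Fin K → EuclideanSpace ℂ (Fin Nt)

/-- Data of a network of `M` base stations with `Nt` antennas, `K` users per base station and
`N` target monitoring terminals. -/
structure ISACSystem (M K Nt N : ℕ) where
  /-- `h i m k`: channel from base station `i` to user `(m, k)` -/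
  h : Fin M → Fin M → Fin K → EuclideanSpace ℂ (Fin Nt)
  /-- steering vector as a function of the angle -/
  a : ℝ → EuclideanSpace ℂ (Fin Nt)
  /-- direction of the target seen from base station `m` -/
  θ : Fin M → ℝ
  /-- the `2 × MN` matrix `Λ` -/
  Lam : Matrix (Fin 2) (Fin M × Fin N) ℝ
  /-- path coefficient `ε_{m,n}` of base station `m`, target, terminal `n` -/
  g : Fin M → Fin N → ℂ
  /-- observation time -/
  T : ℝ
  /-- effective bandwidth -/
  β : ℝ
  /-- standard deviation of the noise at the terminals -/
  σs : ℝ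
  /-- standard deviation of the noise at the users -/
  σn : ℝ
  /-- power budget of each base station -/
  P : ℝ

namespace ISACSystem

variable {M K Nt N : ℕ} (S : ISACSystem M K Nt N)

/-- `h_{i,m,k}ᴴ v`. -/
def rx (i m : Fin M) (k : Fin K) (v : EuclideanSpace ℂ (Fin Nt)) : ℂ := inner ℂ (S.h i m k) v

/-- `a(θ_m)ᵀ v`. -/
def tx (m : Fin M) (v : EuclideanSpace ℂ (Fin Nt)) : ℂ := ∑ i, S.a (S.θ m) i * v i

/-- Interference `ω` at user `(m, k)`. -/
def interference (f : Beams M K Nt) (m : Fin M) (k : Fin K) : ℝ :=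
  ∑ p : Fin M × Fin K, if p = (m, k) then 0 else ‖S.rx p.1 m k (f p.1 p.2)‖ ^ 2

/-- The signal-to-interference-plus-noise ratio of user `(m, k)`. -/
def sinr (f : Beams M K Nt) (m : Fin M) (k : Fin K) : ℝ :=
  ‖S.rx m m k (f m k)‖ ^ 2 / (S.interference f m k + S.σn ^ 2)

/-- The smallest SINR in the network. -/
def minSinr (f : Beams M K Nt) : ℝ := ⨅ p : Fin M × Fin K, S.sinr f p.1 p.2

/-- Transmit power of base station `m`. -/
def power (f : Beams M K Nt) (m : Fin M) : ℝ := ∑ k, ‖f m k‖ ^ 2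

/-- Illumination `aᵀ(θ_m) (∑ₖ f_{m,k} f_{m,k}ᴴ) a^*(θ_m)` of the target by base station `m`. -/
def illum (f : Beams M K Nt) (m : Fin M) : ℝ := ∑ k, ‖S.tx m (f m k)‖ ^ 2

/-- `Λ diag(q₁ Ẑ₁, …, q_M Ẑ_M) Λᵀ` with `Ẑ_m = (8π²Tβ²/σs²) diag(|ε_{m,1}|², …, |ε_{m,N}|²)`. -/
def fisher (q : Fin M → ℝ) : Matrix (Fin 2) (Fin 2) ℝ :=
  S.Lam * Matrix.diagonal (fun p : Fin M × Fin N =>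
    q p.1 * (8 * Real.pi ^ 2 * S.T * S.β ^ 2 / S.σs ^ 2 * ‖S.g p.1 p.2‖ ^ 2)) * S.Lam.transpose

/-- The Cramér–Rao bound as a function of the illuminations (meaningful where `fisher q` is
positive definite). -/
def crlb (q : Fin M → ℝ) : ℝ := ((S.fisher q)⁻¹).trace

/-- The constraint `crlb q ≤ ε`, on the domain of positive definite Fisher matrices. -/
def CrlbLe (ε : ℝ) (q : Fin M → ℝ) : Prop := (S.fisher q).PosDef ∧ S.crlb q ≤ ε

/-! ### The communication-centric problem -/

/-- `f` is feasible: per-station power budgets and the CRLB constraint. -/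
def Feasible (ε : ℝ) (f : Beams M K Nt) : Prop :=
  (∀ m, power f m ≤ S.P) ∧ S.CrlbLe ε (S.illum f)

/-- The problem `max_f min_{m,k} SINR_{m,k}(f)` under the power and CRLB constraints, in the
smooth form: maximize `t` over `(f, t)` subject to `t ≤ SINR_{m,k}(f)` for all `(m, k)`, the power
constraints and the CRLB constraint. -/
def commProblem (ε : ℝ) :
    MaxProblem (Beams M K Nt × ℝ) ((Fin M × Fin K) ⊕ Fin M ⊕ Unit) where
  dom := {x | (S.fisher (S.illum x.1)).PosDef}
  obj := fun x => x.2
  con := Sum.elim (fun p x => x.2 - S.sinr x.1 p.1 p.2)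
    (Sum.elim (fun m x => power x.1 m - S.P) (fun _ x => S.crlb (S.illum x.1) - ε))

/-- `f` is a KKT point of the max–min problem. -/
def IsKKTPoint (ε : ℝ) (f : Beams M K Nt) : Prop :=
  (S.commProblem ε).IsKKT (f, S.minSinr f)

/-- `f` satisfies the Mangasarian–Fromovitz condition for the max–min problem. -/
def IsRegular (ε : ℝ) (f : Beams M K Nt) : Prop :=
  (S.commProblem ε).MFCQ (f, S.minSinr f)

/-! ### The successive convex approximation algorithm -/

end ISACSystem

/-- What the algorithm passes from one iteration to the next: `f`, `ρ`, `u`. -/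
structure SCAState (M K Nt : ℕ) where
  f : Beams M K Nt
  ρ : Fin M → Fin K → ℝ
  u : Fin M → Fin K → ℝ

namespace ISACSystem

variable {M K Nt N : ℕ} (S : ISACSystem M K Nt N)

/-- Feasible points `(f, ρ, u, q, ϖ)`, with `y = (f, ρ, u)`, of the convex surrogate problem built
at the state `z = (f⁽ʳ⁾, ρ⁽ʳ⁾, u⁽ʳ⁾)`. -/
structure SurrogateFeasible (ε : ℝ) (z y : SCAState M K Nt) (q : Fin M → ℝ) (ϖ : ℝ) : Prop where
  power_le : ∀ m, power y.f m ≤ S.P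
  illum_ge : ∀ m, q m ≤
    2 * (∑ k, star (S.tx m (y.f m k)) * S.tx m (z.f m k)).re - S.illum z.f m
  signal_ge : ∀ m k, (y.ρ m k) ^ 2 ≤
    2 * (star (S.rx m m k (y.f m k)) * S.rx m m k (z.f m k)).re
      - ‖S.rx m m k (z.f m k)‖ ^ 2
  interference_le : ∀ m k, S.σn ^ 2 + S.interference y.f m k ≤ y.u m k
  crlb_le : S.CrlbLe ε q
  ratio_ge : ∀ m k, ϖ ≤
    2 * z.ρ m k / z.u m k * y.ρ m k - (z.ρ m k) ^ 2 / (z.u m k) ^ 2 * y.u m k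

/-- Optimal solutions of the surrogate problem (maximize `ϖ`) built at the state `z`. -/
def SurrogateOptimal (ε : ℝ) (z y : SCAState M K Nt) (q : Fin M → ℝ) (ϖ : ℝ) : Prop :=
  S.SurrogateFeasible ε z y q ϖ ∧
    ∀ y' q' ϖ', S.SurrogateFeasible ε z y' q' ϖ' → ϖ' ≤ ϖ

/-- Admissible initial states: `f⁽⁰⁾` is feasible for the max–min problem, `ρ⁽⁰⁾` and `u⁽⁰⁾`
are feasible auxiliary variables, and no `ρ⁽⁰⁾_{m,k}` vanishes. -/
structure IsInitial (ε : ℝ) (z : SCAState M K Nt) : Prop where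
  feasible : S.Feasible ε z.f
  signal : ∀ m k, (z.ρ m k) ^ 2 ≤ ‖S.rx m m k (z.f m k)‖ ^ 2
  interference : ∀ m k, S.σn ^ 2 + S.interference z.f m k ≤ z.u m k
  rho_ne : ∀ m k, z.ρ m k ≠ 0

/-- A run of the algorithm: from the state `z r`, iteration `r + 1` returns an optimal
solution `(z (r + 1), q r, ϖ r)` of the surrogate problem built at `z r`. -/
def IsRun (ε : ℝ) (z : ℕ → SCAState M K Nt) (q : ℕ → Fin M → ℝ) (ϖ : ℕ → ℝ) : Prop :=
  S.IsInitial ε (z 0) ∧ ∀ r, S.SurrogateOptimal ε (z r) (z (r + 1)) (q r) (ϖ r)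

/-- `fs` is an accumulation point of the beamformers produced by a run. -/
def IsAccumulationPoint (z : ℕ → SCAState M K Nt) (fs : Beams M K Nt) : Prop :=
  MapClusterPt fs atTop (fun r => (z r).f)

end ISACSystem

end

/-!
# Convergence of successive convex approximation for max–min SINR under a CRLB constraint

*The surrogate problem.* The surrogates of the illuminations, signal powers and SINRs are
concave minorants. The first two touch the function they replace, with the same first derivative,
at the current beamformers; the last does so when the auxiliary variables are tight. For fixed
beamformers the optimal auxiliary variables are explicit, so a surrogate problem amounts to
maximizing the smallest `surrogateSinr` over the compact set `SurrogateDomain`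
(`exists_surrogateOptimal`). For the CRLB constraint this uses that `tr J⁻¹` decreases in the
illuminations (`CrlbLe.mono`) and that, for `2 × 2` matrices, `J ≻ 0` and `tr J⁻¹ ≤ ε` together
are a closed condition (`crlbLe_iff`).

*Monotonicity.* The current state is feasible for its own surrogate problem with the value
`min ρ² / u`, and no surrogate value exceeds `ρ² / u` of the new state. Hence the optimal values
increase and stay positive. Positivity keeps `u ≤ ρ² / ϖ` bounded, although no constraint bounds
`u`, so along a subsequence the whole state converges to some `zs` with `min ρ² / u ≥ L`.

*Accumulation points.* A point that satisfies the constraints of the limiting surrogate problem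
strictly, with value above `L`, would be feasible with value above `L` for the problems of the run
close to the limit, which is absurd (`IsRun.exists_surrogateSinr_le`). At the limiting beamformers
the surrogate SINR exceeds `L` unless `ρ` and `u` are tight and the SINR equals `L`, and in that
case it is tangent to the SINR. So no direction can strictly decrease the active power and CRLB
constraints while strictly increasing every SINR equal to `L` (`IsRun.not_exists_direction`). The
Mangasarian–Fromovitz direction would be one if the smallest SINR were above `L`; if multipliers
did not exist, Gordan's alternative together with that condition would provide one
(`MaxProblem.exists_ascent_of_not_isKKT`).

*Regularity.* The variable `t` can absorb the SINR constraints, and scaling `f` down decreases all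
powers, so only an active CRLB constraint can destroy regularity. If some base station `m` with a
nonzero contribution to the Fisher matrix has an illumination strictly between `0` and its maximum
`‖a(θ_m)‖² P`, turning its beamformers towards the conjugate steering vector improves the bound
without increasing an exhausted power (`Feasible.isRegular_of_illum`). At an irregular point the
bound therefore equals its value at one of finitely many illumination vectors
(`finite_setOf_not_isRegular`).
-/

noncomputable section

/-! ### Strict descent directions -/

/-- **Gordan's alternative.** Finitely many linear forms either are all negative at a common
vector, or admit a nontrivial nonnegative linear relation. -/
theorem gordan_alternative {E κ : Type*} [AddCommGroup E] [Module ℝ E] [Fintype κ]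
    (g : κ → E →ₗ[ℝ] ℝ) (hg : ¬ ∃ v, ∀ j, g j v < 0) :
    ∃ c : κ → ℝ, (∀ j, 0 ≤ c j) ∧ c ≠ 0 ∧ ∀ v, ∑ j, c j * g j v = 0 := by
  classical
  -- Separate the range of `v ↦ (g j v)_j` from the open negative orthant.
  set A : E →ₗ[ℝ] (κ → ℝ) := LinearMap.pi g with hA
  set N : Set (κ → ℝ) := Set.univ.pi fun _ => Set.Iio 0 with hN
  have hNo : IsOpen N := isOpen_set_pi Set.finite_univ fun _ _ => isOpen_Iio
  have hNc : Convex ℝ N := convex_pi fun _ _ => convex_Iio 0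
  have hdisj : Disjoint N (LinearMap.range A : Set (κ → ℝ)) := by
    rw [Set.disjoint_left]
    rintro _ hx ⟨v, rfl⟩
    exact hg ⟨v, fun j => hx j (Set.mem_univ j)⟩
  obtain ⟨φ, u, hu1, hu2⟩ :=
    geometric_hahn_banach_open hNc hNo (LinearMap.range A).convex hdisj
  have hu0 : u ≤ 0 := by simpa using hu2 0 (Submodule.zero_mem _)
  have hzero : ∀ v, φ (A v) = 0 := by
    intro v
    by_contra hne
    have h := hu2 (A (((u - 1) / φ (A v)) • v)) ⟨_, rfl⟩
    rw [map_smul, map_smul, smul_eq_mul, div_mul_cancel₀ _ hne] at h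
    linarith
  have hsum : ∀ x : κ → ℝ, φ x = ∑ j, φ (Pi.single j 1) * x j := by
    intro x
    conv_lhs => rw [pi_eq_sum_univ' x]
    simp [map_sum, mul_comm]
  have hneg : ∀ x ∈ N, φ x < 0 := fun x hx => (hu1 x hx).trans_le hu0
  refine ⟨fun j => φ (Pi.single j 1), ?_, ?_, ?_⟩
  · intro j
    -- `-single j 1` lies in the closure of the negative orthant
    have hcl : φ (-Pi.single j 1) ≤ 0 := by
      have hlim : Tendsto (fun t : ℝ => φ (-Pi.single j 1 - t • fun _ => 1)) (𝓝[>] 0)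
          (𝓝 (φ (-Pi.single j 1))) := by
        have hc : Continuous fun t : ℝ => φ (-Pi.single j 1 - t • fun _ => 1) := by fun_prop
        simpa using (hc.tendsto 0).mono_left nhdsWithin_le_nhds
      refine le_of_tendsto hlim ?_
      filter_upwards [self_mem_nhdsWithin] with t ht
      refine (hneg _ fun i _ => ?_).le
      have ht' : (0 : ℝ) < t := ht
      by_cases hij : i = j
      · subst hij; simp; linarith
      · simp [hij, ht']
    rw [map_neg] at hcl
    linarith
  · intro h0
    have h1 := hneg (fun _ => -1) fun _ _ => by simp
    rw [hsum] at h1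
    have : ∀ j, φ (Pi.single j 1) = 0 := fun j => congrFun h0 j
    simp [this] at h1
  · intro v
    have := hsum (A v)
    rw [hzero v] at this
    exact this.symm

namespace MaxProblem

variable {E κ : Type*} [NormedAddCommGroup E] [NormedSpace ℝ E] [Fintype κ]

/-- At a feasible point satisfying the Mangasarian–Fromovitz condition, the absence of
multipliers yields a direction of strict first-order ascent of the objective and strict
first-order descent of all active constraints. -/
theorem exists_ascent_of_not_isKKT {Q : MaxProblem E κ} {x : E} (hx : Q.Feasible x)
    (hobj : DifferentiableAt ℝ Q.obj x) (hcon : ∀ j, DifferentiableAt ℝ (Q.con j) x)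
    (hreg : Q.MFCQ x) (hkkt : ¬ Q.IsKKT x) :
    ∃ v, 0 < fderiv ℝ Q.obj x v ∧ ∀ j, Q.con j x = 0 → fderiv ℝ (Q.con j) x v < 0 := by
  classical
  by_contra hno
  let g : Option {j // Q.con j x = 0} → E →ₗ[ℝ] ℝ := fun o =>
    o.elim (-(fderiv ℝ Q.obj x).toLinearMap) fun j => (fderiv ℝ (Q.con j) x).toLinearMap
  have hg : ¬ ∃ v, ∀ o, g o v < 0 := by
    rintro ⟨v, hv⟩
    refine hno ⟨v, ?_, fun j hj => hv (some ⟨j, hj⟩)⟩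
    have : -(fderiv ℝ Q.obj x v) < 0 := hv none
    linarith
  obtain ⟨c, hc0, hcne, hc⟩ := gordan_alternative g hg
  have hrel : ∀ v, ∑ j : {j // Q.con j x = 0}, c (some j) * fderiv ℝ (Q.con j) x v
      = c none * fderiv ℝ Q.obj x v := by
    intro v
    have h := hc v
    rw [Fintype.sum_option] at h
    have h' : c none * -(fderiv ℝ Q.obj x v)
      + ∑ j : {j // Q.con j x = 0}, c (some j) * fderiv ℝ (Q.con j) x v = 0 := h
    linarith
  obtain ⟨d, hd⟩ := hreg
  -- The constraint qualification makes the multiplier of the objective positive.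
  have hpos : 0 < c none := by
    refine lt_of_le_of_ne (hc0 none) fun h0 => hcne ?_
    have hs := hrel d
    rw [← h0, zero_mul] at hs
    have hz := (Finset.sum_eq_zero_iff_of_nonpos (s := Finset.univ)
      (f := fun j : {j // Q.con j x = 0} => c (some j) * fderiv ℝ (Q.con j) x d)
      (fun j _ => mul_nonpos_of_nonneg_of_nonpos (hc0 _) (hd j j.2).le)).1 hs
    funext o
    cases o with
    | none => exact h0.symm
    | some j =>
      have := hz j (Finset.mem_univ j)
      exact (mul_eq_zero.1 this).resolve_right (hd j j.2).ne
  refine hkkt ⟨hx, hobj, hcon, fun j => if h : Q.con j x = 0 then c (some ⟨j, h⟩) / c none else 0,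
    fun j => ?_, fun j => ?_, ?_⟩
  · dsimp only; split_ifs with h
    · exact div_nonneg (hc0 _) hpos.le
    · exact le_rfl
  · dsimp only; split_ifs with h <;> simp [h]
  · ext v
    rw [_root_.sum_apply]
    have hsplit : ∑ j, ((if h : Q.con j x = 0 then c (some ⟨j, h⟩) / c none else 0) •
        fderiv ℝ (Q.con j) x) v
        = ∑ j : {j // Q.con j x = 0}, c (some j) / c none * fderiv ℝ (Q.con j) x v := by
      rw [← Fintype.sum_subtype_add_sum_subtype (fun j => Q.con j x = 0)]
      rw [Finset.sum_eq_zero (s := Finset.univ (α := {j // ¬ Q.con j x = 0}))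
        fun j _ => by simp [j.2], add_zero]
      exact Finset.sum_congr rfl fun j _ => by simp [j.2]
    rw [hsplit]
    have h := hrel v
    have : fderiv ℝ Q.obj x v = (c none * fderiv ℝ Q.obj x v) / c none := by
      field_simp
    rw [this, ← h, Finset.sum_div]
    exact Finset.sum_congr rfl fun j _ => by ring

end MaxProblem

/-- A function that is at most `c` at `0`, and has negative derivative there if it equals `c`, is
less than `c` shortly after `0`. -/
theorem eventually_lt_of_hasDerivAt {φ : ℝ → ℝ} {φ' c : ℝ} (h : HasDerivAt φ φ' 0)
    (hle : φ 0 ≤ c) (hneg : φ 0 = c → φ' < 0) : ∀ᶠ t in 𝓝[>] 0, φ t < c := by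
  rcases hle.lt_or_eq with hlt | heq
  · exact (h.continuousAt.eventually_lt continuousAt_const hlt).filter_mono nhdsWithin_le_nhds
  · have hs := (hasDerivAt_iff_tendsto_slope.1 h).mono_left
      (nhdsWithin_mono 0 (fun t (ht : 0 < t) => ht.ne') : 𝓝[>] (0 : ℝ) ≤ 𝓝[≠] 0)
    filter_upwards [hs.eventually_lt_const (hneg heq), self_mem_nhdsWithin] with t ht ht0
    have ht0' : (0 : ℝ) < t := ht0
    rw [slope_def_field, sub_zero, div_lt_iff₀ ht0', zero_mul] at ht
    linarith

/-- The distance from a bounded sequence to a set containing all its cluster points tends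
to zero. -/
theorem tendsto_infDist_of_mapClusterPt_mem {E : Type*} [MetricSpace E] [ProperSpace E]
    {x : ℕ → E} {A : Set E} (hb : Bornology.IsBounded (Set.range x))
    (hA : ∀ a, MapClusterPt a atTop x → a ∈ A) :
    Tendsto (fun n => Metric.infDist (x n) A) atTop (𝓝 0) := by
  refine tendsto_of_subseq_tendsto fun ns hns => ?_
  obtain ⟨a, -, φ, hφ, hlim⟩ := tendsto_subseq_of_bounded hb (x := fun n => x (ns n))
    fun n => ⟨ns n, rfl⟩
  have ha : a ∈ A := hA a <| (hlim.mapClusterPt).of_comp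
    (hns.comp hφ.tendsto_atTop)
  refine ⟨φ, squeeze_zero (fun _ => Metric.infDist_nonneg)
    (fun n => Metric.infDist_le_dist_of_mem ha) ?_⟩
  simpa using hlim.dist (tendsto_const_nhds (x := a))

namespace ISACSystem

variable {M K Nt N : ℕ} (S : ISACSystem M K Nt N)

/-! ### The Cramér–Rao bound of a `2 × 2` Fisher matrix -/

/-- The coefficient `(8π²Tβ²/σs²) |ε_{m,n}|²` of the path `p = (m, n)` in the Fisher matrix. -/
def weight (p : Fin M × Fin N) : ℝ :=
  8 * Real.pi ^ 2 * S.T * S.β ^ 2 / S.σs ^ 2 * ‖S.g p.1 p.2‖ ^ 2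

/-- The entries of the Fisher matrix as linear forms in the illuminations. -/
def fisherForm (i j : Fin 2) : (Fin M → ℝ) →L[ℝ] ℝ :=
  ∑ p : Fin M × Fin N, (S.Lam i p * S.Lam j p * S.weight p) •
    (ContinuousLinearMap.proj p.1 : (Fin M → ℝ) →L[ℝ] ℝ)

/-- The trace of the Fisher matrix. -/
def fisherTr (q : Fin M → ℝ) : ℝ := S.fisherForm 0 0 q + S.fisherForm 1 1 q

/-- The determinant of the Fisher matrix. -/
def fisherDet (q : Fin M → ℝ) : ℝ :=
  S.fisherForm 0 0 q * S.fisherForm 1 1 q - S.fisherForm 0 1 q ^ 2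

theorem fisherForm_apply (i j : Fin 2) (q : Fin M → ℝ) :
    S.fisherForm i j q = ∑ p, S.Lam i p * S.Lam j p * S.weight p * q p.1 := by
  simp [fisherForm, _root_.sum_apply]

theorem fisher_apply (q : Fin M → ℝ) (i j : Fin 2) : S.fisher q i j = S.fisherForm i j q := by
  rw [fisherForm_apply, fisher, Matrix.mul_apply]
  refine Finset.sum_congr rfl fun p _ => ?_
  rw [Matrix.mul_diagonal, Matrix.transpose_apply, weight]
  ring

theorem fisherForm_comm (i j : Fin 2) (q : Fin M → ℝ) :
    S.fisherForm i j q = S.fisherForm j i q := by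
  simp only [fisherForm_apply, mul_comm (S.Lam i _)]

theorem det_fisher (q : Fin M → ℝ) : (S.fisher q).det = S.fisherDet q := by
  rw [Matrix.det_fin_two, fisherDet]
  simp only [fisher_apply, S.fisherForm_comm 1 0]
  ring

theorem crlb_eq (q : Fin M → ℝ) : S.crlb q = S.fisherTr q / S.fisherDet q := by
  rw [crlb, Matrix.inv_def, Matrix.trace_smul, Matrix.trace_fin_two, Matrix.adjugate_fin_two,
    det_fisher, Ring.inverse_eq_inv', smul_eq_mul, fisherTr]
  simp only [fisher_apply, Matrix.of_apply, Matrix.cons_val', Matrix.cons_val_zero,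
    Matrix.cons_val_one, Matrix.cons_val_fin_one]
  ring

theorem posDef_fisher_iff (q : Fin M → ℝ) :
    (S.fisher q).PosDef ↔ 0 < S.fisherTr q ∧ 0 < S.fisherDet q := by
  constructor
  · intro h
    have h0 := h.diag_pos (i := 0)
    have h1 := h.diag_pos (i := 1)
    have h2 := h.det_pos
    rw [det_fisher] at h2
    rw [fisher_apply] at h0 h1
    exact ⟨add_pos h0 h1, h2⟩
  · rintro ⟨ht, hd⟩
    rw [fisherTr] at ht
    rw [fisherDet] at hd
    have h0 : 0 < S.fisherForm 0 0 q := by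
      by_contra hneg
      nlinarith [sq_nonneg (S.fisherForm 0 1 q)]
    rw [Matrix.posDef_iff_dotProduct_mulVec]
    refine ⟨?_, fun x hx => ?_⟩
    · ext i j
      simp [fisher_apply, S.fisherForm_comm i j]
    · have hval : star x ⬝ᵥ (S.fisher q).mulVec x = S.fisherForm 0 0 q * x 0 ^ 2 +
          2 * S.fisherForm 0 1 q * x 0 * x 1 + S.fisherForm 1 1 q * x 1 ^ 2 := by
        simp [dotProduct, Matrix.mulVec, Fin.sum_univ_two, fisher_apply, S.fisherForm_comm 1 0]
        ring
      rw [hval]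
      refine pos_of_mul_pos_right (a := S.fisherForm 0 0 q) ?_ h0.le
      have hsq : S.fisherForm 0 0 q * (S.fisherForm 0 0 q * x 0 ^ 2 +
          2 * S.fisherForm 0 1 q * x 0 * x 1 + S.fisherForm 1 1 q * x 1 ^ 2) =
          (S.fisherForm 0 0 q * x 0 + S.fisherForm 0 1 q * x 1) ^ 2 +
          (S.fisherForm 0 0 q * S.fisherForm 1 1 q - S.fisherForm 0 1 q ^ 2) * x 1 ^ 2 := by ring
      rw [hsq]
      by_cases h1 : x 1 = 0
      · have hx0 : x 0 ≠ 0 := by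
          intro hx0
          apply hx
          ext i
          fin_cases i <;> assumption
        rw [h1]
        have := pow_pos h0 2
        have := (sq_pos_iff (a := x 0)).2 hx0
        have : 0 < S.fisherForm 0 0 q ^ 2 * x 0 ^ 2 := by positivity
        nlinarith
      · have := (sq_pos_iff (a := x 1)).2 h1
        have := mul_pos hd this
        positivity

/-- The CRLB constraint as a system of non-strict inequalities in the trace and the determinant:
as `4 det ≤ tr²`, the bound `tr ≤ ε det` keeps the trace above `4 / ε`. -/
theorem crlbLe_iff (ε : ℝ) (q : Fin M → ℝ) :
    S.CrlbLe ε q ↔ 0 < ε ∧ 4 ≤ ε * S.fisherTr q ∧ S.fisherTr q ≤ ε * S.fisherDet q := by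
  have hamgm : 4 * S.fisherDet q ≤ S.fisherTr q ^ 2 := by
    rw [fisherDet, fisherTr]
    nlinarith [sq_nonneg (S.fisherForm 0 0 q - S.fisherForm 1 1 q),
      sq_nonneg (S.fisherForm 0 1 q)]
  rw [CrlbLe, posDef_fisher_iff, crlb_eq]
  constructor
  · rintro ⟨⟨ht, hd⟩, hle⟩
    rw [div_le_iff₀ hd] at hle
    have hε : 0 < ε := by
      by_contra hneg
      nlinarith
    refine ⟨hε, ?_, hle⟩
    have : 4 * S.fisherTr q ≤ ε * S.fisherTr q * S.fisherTr q := by nlinarith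
    exact le_of_mul_le_mul_right this ht
  · rintro ⟨hε, ht4, hle⟩
    have ht : 0 < S.fisherTr q := by
      by_contra hneg
      nlinarith
    have hd : 0 < S.fisherDet q := by
      by_contra hneg
      nlinarith
    exact ⟨⟨ht, hd⟩, (div_le_iff₀ hd).2 hle⟩

theorem continuous_fisherTr : Continuous S.fisherTr := by
  unfold fisherTr; fun_prop

theorem continuous_fisherDet : Continuous S.fisherDet := by
  unfold fisherDet; fun_prop

theorem isClosed_crlbLe (ε : ℝ) : IsClosed {q | S.CrlbLe ε q} := by
  simp only [crlbLe_iff]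
  exact (isClosed_const).and <|
    (isClosed_le continuous_const (continuous_const.mul S.continuous_fisherTr)).and
    (isClosed_le S.continuous_fisherTr (continuous_const.mul S.continuous_fisherDet))

theorem isOpen_posDef_fisher : IsOpen {q | (S.fisher q).PosDef} := by
  simp only [posDef_fisher_iff]
  exact (isOpen_lt continuous_const S.continuous_fisherTr).and
    (isOpen_lt continuous_const S.continuous_fisherDet)

theorem differentiableAt_crlb {q : Fin M → ℝ} (hq : (S.fisher q).PosDef) :
    DifferentiableAt ℝ S.crlb q := by
  have h := ((posDef_fisher_iff S q).1 hq).2.ne'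
  have heq : S.crlb = fun q => S.fisherTr q / S.fisherDet q := funext S.crlb_eq
  rw [heq]
  have h1 : DifferentiableAt ℝ S.fisherTr q := by unfold fisherTr; fun_prop
  have h2 : DifferentiableAt ℝ S.fisherDet q := by unfold fisherDet; fun_prop
  simpa only [div_eq_mul_inv] using h1.fun_mul (h2.fun_inv h)

/-- The derivative of `tr J⁻¹` at `J = fisher q` in the direction `e`, that is,
`-∑ₚ e_p w_p ‖J⁻¹ x_p‖²`, where `x_p` are the columns of `Λ` and `w_p` the path weights. -/
def crlbSlope (q e : Fin M → ℝ) : ℝ :=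
  -(∑ p : Fin M × Fin N, e p.1 * (S.weight p *
    ((S.Lam 0 p * S.fisherForm 1 1 q - S.Lam 1 p * S.fisherForm 0 1 q) ^ 2 +
      (S.Lam 0 p * S.fisherForm 0 1 q - S.Lam 1 p * S.fisherForm 0 0 q) ^ 2))) / S.fisherDet q ^ 2

theorem sum_weight_adjugate (q e : Fin M → ℝ) :
    ∑ p : Fin M × Fin N, e p.1 * (S.weight p *
      ((S.Lam 0 p * S.fisherForm 1 1 q - S.Lam 1 p * S.fisherForm 0 1 q) ^ 2 +
        (S.Lam 0 p * S.fisherForm 0 1 q - S.Lam 1 p * S.fisherForm 0 0 q) ^ 2)) =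
    S.fisherForm 0 0 e * (S.fisherForm 0 1 q ^ 2 + S.fisherForm 1 1 q ^ 2) +
      S.fisherForm 1 1 e * (S.fisherForm 0 0 q ^ 2 + S.fisherForm 0 1 q ^ 2) -
      2 * S.fisherForm 0 1 q * S.fisherForm 0 1 e *
        (S.fisherForm 0 0 q + S.fisherForm 1 1 q) := by
  rw [S.fisherForm_apply 0 0 e, S.fisherForm_apply 1 1 e, S.fisherForm_apply 0 1 e,
    Finset.sum_mul, Finset.sum_mul, Finset.mul_sum, Finset.sum_mul, ← Finset.sum_add_distrib,
    ← Finset.sum_sub_distrib]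
  exact Finset.sum_congr rfl fun p _ => by ring

theorem hasDerivAt_crlb_comp {γ : ℝ → Fin M → ℝ} {e : Fin M → ℝ} {t : ℝ}
    (hγ : HasDerivAt γ e t) (hq : (S.fisher (γ t)).PosDef) :
    HasDerivAt (fun s => S.crlb (γ s)) (S.crlbSlope (γ t) e) t := by
  have hd := ((posDef_fisher_iff S _).1 hq).2.ne'
  have hf : ∀ i j, HasDerivAt (fun s => S.fisherForm i j (γ s)) (S.fisherForm i j e) t :=
    fun i j => (S.fisherForm i j).hasFDerivAt.comp_hasDerivAt t hγ
  have h := ((hf 0 0).add (hf 1 1)).div (((hf 0 0).mul (hf 1 1)).sub ((hf 0 1).pow 2)) hd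
  have heq : (fun s => S.crlb (γ s)) = fun s => S.fisherTr (γ s) / S.fisherDet (γ s) :=
    funext fun s => S.crlb_eq _
  rw [heq]
  refine h.congr_deriv ?_
  rw [crlbSlope, sum_weight_adjugate]
  simp only [fisherDet, Pi.add_apply, Pi.sub_apply, Pi.mul_apply, Pi.pow_apply]
  congr 1
  push_cast
  ring

variable {S}

theorem crlbSlope_neg (hw : ∀ p, 0 ≤ S.weight p) {q e : Fin M → ℝ} (hq : (S.fisher q).PosDef)
    (he : ∀ m, 0 ≤ e m) {p : Fin M × Fin N} (hep : 0 < e p.1) (hwp : 0 < S.weight p)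
    (hcol : S.Lam 0 p ≠ 0 ∨ S.Lam 1 p ≠ 0) : S.crlbSlope q e < 0 := by
  have hd := ((posDef_fisher_iff S _).1 hq).2
  rw [crlbSlope, neg_div, neg_lt_zero]
  refine div_pos (Finset.sum_pos' (fun i _ => mul_nonneg (he _) (mul_nonneg (hw _) (by positivity)))
    ⟨p, Finset.mem_univ _, mul_pos hep (mul_pos hwp ?_)⟩) (pow_pos hd 2)
  rw [fisherDet] at hd
  -- both squares vanish only if the invertible Fisher matrix kills a rotated column
  by_contra hle
  have h1 : S.Lam 0 p * S.fisherForm 1 1 q - S.Lam 1 p * S.fisherForm 0 1 q = 0 := by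
    rw [← sq_eq_zero_iff]
    linarith [sq_nonneg (S.Lam 0 p * S.fisherForm 1 1 q - S.Lam 1 p * S.fisherForm 0 1 q),
      sq_nonneg (S.Lam 0 p * S.fisherForm 0 1 q - S.Lam 1 p * S.fisherForm 0 0 q)]
  have h2 : S.Lam 0 p * S.fisherForm 0 1 q - S.Lam 1 p * S.fisherForm 0 0 q = 0 := by
    rw [← sq_eq_zero_iff]
    linarith [sq_nonneg (S.Lam 0 p * S.fisherForm 1 1 q - S.Lam 1 p * S.fisherForm 0 1 q),
      sq_nonneg (S.Lam 0 p * S.fisherForm 0 1 q - S.Lam 1 p * S.fisherForm 0 0 q)]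
  have h3 : S.Lam 0 p * (S.fisherForm 0 0 q * S.fisherForm 1 1 q - S.fisherForm 0 1 q ^ 2) = 0 := by
    linear_combination S.fisherForm 0 0 q * h1 - S.fisherForm 0 1 q * h2
  have h4 : S.Lam 1 p * (S.fisherForm 0 0 q * S.fisherForm 1 1 q - S.fisherForm 0 1 q ^ 2) = 0 := by
    linear_combination S.fisherForm 0 1 q * h1 - S.fisherForm 1 1 q * h2
  rcases hcol with h | h
  · exact h ((mul_eq_zero.1 h3).resolve_right hd.ne')
  · exact h ((mul_eq_zero.1 h4).resolve_right hd.ne')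

/-- More illumination improves the Cramér–Rao bound. -/
theorem CrlbLe.mono (hw : ∀ p, 0 ≤ S.weight p) {ε : ℝ} {q q' : Fin M → ℝ}
    (hq : S.CrlbLe ε q) (hle : ∀ m, q m ≤ q' m) : S.CrlbLe ε q' := by
  obtain ⟨hpd, hc⟩ := hq
  obtain ⟨ht, hd⟩ := (posDef_fisher_iff S _).1 hpd
  obtain ⟨e, rfl⟩ : ∃ e, q' = q + e := ⟨q' - q, by simp⟩
  have he : ∀ m, 0 ≤ e m := fun m => by have := hle m; simpa using this
  have hnn : ∀ i, 0 ≤ S.fisherForm i i e := fun i => by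
    rw [fisherForm_apply]
    exact Finset.sum_nonneg fun p _ =>
      mul_nonneg (mul_nonneg (mul_self_nonneg _) (hw p)) (he _)
  have hcs : S.fisherForm 0 1 e ^ 2 ≤ S.fisherForm 0 0 e * S.fisherForm 1 1 e := by
    simp only [fisherForm_apply]
    exact Finset.sum_sq_le_sum_mul_sum_of_sq_le_mul _
      (fun p _ => mul_nonneg (mul_nonneg (mul_self_nonneg _) (hw p)) (he _))
      (fun p _ => mul_nonneg (mul_nonneg (mul_self_nonneg _) (hw p)) (he _))
      (fun p _ => le_of_eq (by ring))
  have hadj : 0 ≤ S.fisherForm 0 0 e * (S.fisherForm 0 1 q ^ 2 + S.fisherForm 1 1 q ^ 2) +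
      S.fisherForm 1 1 e * (S.fisherForm 0 0 q ^ 2 + S.fisherForm 0 1 q ^ 2) -
      2 * S.fisherForm 0 1 q * S.fisherForm 0 1 e *
        (S.fisherForm 0 0 q + S.fisherForm 1 1 q) := by
    rw [← sum_weight_adjugate]
    exact Finset.sum_nonneg fun p _ => mul_nonneg (he _) (mul_nonneg (hw p) (by positivity))
  have ht' : S.fisherTr q ≤ S.fisherTr (q + e) := by
    simp only [fisherTr, map_add]
    linarith [hnn 0, hnn 1]
  -- `tr(J) det(J + E) - tr(J + E) det(J) = tr(adj(J) E adj(J)) + tr(J) det(E)`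
  have hcross : S.fisherTr (q + e) * S.fisherDet q ≤ S.fisherTr q * S.fisherDet (q + e) := by
    have h1 := mul_nonneg ht.le (sub_nonneg.2 hcs)
    simp only [fisherTr, fisherDet, map_add] at h1 ⊢
    linarith [h1, hadj]
  have hd' : 0 < S.fisherDet (q + e) := by
    have := mul_pos (ht.trans_le ht') hd
    exact pos_of_mul_pos_right (this.trans_le hcross) ht.le
  refine ⟨(posDef_fisher_iff S _).2 ⟨ht.trans_le ht', hd'⟩, le_trans ?_ hc⟩
  rw [crlb_eq, crlb_eq, div_le_div_iff₀ hd' hd]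
  exact hcross

/-- If some nonnegative illumination makes the Fisher matrix positive definite, no path weight is
negative, whatever the sign of the observation time. -/
theorem weight_nonneg_of_posDef {q : Fin M → ℝ} (hq : ∀ m, 0 ≤ q m) (hpd : (S.fisher q).PosDef)
    (p : Fin M × Fin N) : 0 ≤ S.weight p := by
  have hc : 0 ≤ 8 * Real.pi ^ 2 * S.T * S.β ^ 2 / S.σs ^ 2 := by
    by_contra hneg
    have h0 := hpd.diag_pos (i := 0)
    rw [fisher_apply, fisherForm_apply] at h0
    refine h0.not_ge (Finset.sum_nonpos fun p _ => ?_)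
    have : S.weight p ≤ 0 := mul_nonpos_of_nonpos_of_nonneg (not_le.1 hneg).le (by positivity)
    exact mul_nonpos_of_nonpos_of_nonneg
      (mul_nonpos_of_nonneg_of_nonpos (mul_self_nonneg _) this) (hq _)
  exact mul_nonneg hc (by positivity)

end ISACSystem

/-! ### Quadratic functions of the beamformers and their linearizations -/

theorem norm_sq_add_smul {V : Type*} [NormedAddCommGroup V] [InnerProductSpace ℂ V]
    (v w : V) (t : ℝ) :
    ‖v + t • w‖ ^ 2 = ‖v‖ ^ 2 + t * (2 * (inner ℂ w v).re) + t ^ 2 * ‖w‖ ^ 2 := by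
  have h := @norm_add_sq ℂ V _ _ _ v ((t : ℂ) • w)
  have h' : t • w = (t : ℂ) • w := (Complex.coe_smul t w).symm
  rw [h', h, inner_smul_right, norm_smul, mul_pow, Complex.norm_real, Real.norm_eq_abs, sq_abs,
    RCLike.re_to_complex, Complex.re_ofReal_mul, ← inner_conj_symm, Complex.conj_re]
  ring

theorem hasDerivAt_norm_sq_line {V : Type*} [NormedAddCommGroup V] [InnerProductSpace ℂ V]
    (v w : V) : HasDerivAt (fun t : ℝ => ‖v + t • w‖ ^ 2) (2 * (inner ℂ w v).re) 0 := by
  simp only [norm_sq_add_smul]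
  have h := (((hasDerivAt_id' (0 : ℝ)).mul_const (2 * (inner ℂ w v).re)).const_add
    (‖v‖ ^ 2)).fun_add (((hasDerivAt_id' (0 : ℝ)).fun_pow 2).mul_const (‖w‖ ^ 2))
  simpa using h

theorem inner_complex_eq_star_mul (w z : ℂ) : inner ℂ w z = star w * z := by
  rw [RCLike.inner_apply, mul_comm]; rfl

theorem fderiv_apply_eq_of_hasDerivAt {E : Type*} [NormedAddCommGroup E] [NormedSpace ℝ E]
    {g : E → ℝ} {x v : E} {c : ℝ} (hg : DifferentiableAt ℝ g x)
    (hc : HasDerivAt (fun t : ℝ => g (x + t • v)) c 0) : fderiv ℝ g x v = c := by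
  rw [← hg.lineDeriv_eq_fderiv]
  exact HasLineDerivAt.lineDeriv hc

namespace ISACSystem

variable {M K Nt N : ℕ} (S : ISACSystem M K Nt N)

/-- `v ↦ h_{i,m,k}ᴴ v` as a continuous real-linear map. -/
def rxCLM (i m : Fin M) (k : Fin K) : EuclideanSpace ℂ (Fin Nt) →L[ℝ] ℂ :=
  (innerSL ℂ (S.h i m k)).restrictScalars ℝ

/-- The conjugate steering vector of base station `m`. -/
def steer (m : Fin M) : EuclideanSpace ℂ (Fin Nt) := WithLp.toLp 2 fun i => star (S.a (S.θ m) i)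

/-- `v ↦ a(θ_m)ᵀ v` as a continuous real-linear map. -/
def txCLM (m : Fin M) : EuclideanSpace ℂ (Fin Nt) →L[ℝ] ℂ :=
  (innerSL ℂ (S.steer m)).restrictScalars ℝ

theorem rxCLM_apply (i m : Fin M) (k : Fin K) (v : EuclideanSpace ℂ (Fin Nt)) :
    S.rxCLM i m k v = S.rx i m k v := rfl

theorem tx_eq_inner (m : Fin M) (v : EuclideanSpace ℂ (Fin Nt)) :
    S.tx m v = inner ℂ (S.steer m) v := by
  rw [tx, PiLp.inner_apply]
  refine Finset.sum_congr rfl fun i _ => ?_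
  simp [steer, mul_comm]

theorem txCLM_apply (m : Fin M) (v : EuclideanSpace ℂ (Fin Nt)) :
    S.txCLM m v = S.tx m v := (S.tx_eq_inner m v).symm

theorem rx_add_smul (i m : Fin M) (k : Fin K) (v w : EuclideanSpace ℂ (Fin Nt)) (t : ℝ) :
    S.rx i m k (v + t • w) = S.rx i m k v + t • S.rx i m k w := by
  simp only [← rxCLM_apply, map_add, map_smul]

theorem tx_add_smul (m : Fin M) (v w : EuclideanSpace ℂ (Fin Nt)) (t : ℝ) :
    S.tx m (v + t • w) = S.tx m v + t • S.tx m w := by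
  simp only [← txCLM_apply, map_add, map_smul]

@[fun_prop]
theorem continuous_rx (i m : Fin M) (k : Fin K) : Continuous (S.rx i m k) :=
  (S.rxCLM i m k).continuous

@[fun_prop]
theorem continuous_tx (m : Fin M) : Continuous (S.tx m) := by
  have : S.tx m = S.txCLM m := funext fun v => (S.txCLM_apply m v).symm
  rw [this]
  exact (S.txCLM m).continuous

/-- The affine minorant of the illumination `illum f m` built at the beamformers `g`. -/
def illumLin (g f : Beams M K Nt) (m : Fin M) : ℝ :=
  2 * (∑ k, star (S.tx m (f m k)) * S.tx m (g m k)).re - S.illum g m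

/-- The affine minorant of the signal power `‖rx m m k (f m k)‖²` built at the beamformers `g`. -/
def signalLin (g f : Beams M K Nt) (m : Fin M) (k : Fin K) : ℝ :=
  2 * (star (S.rx m m k (f m k)) * S.rx m m k (g m k)).re - ‖S.rx m m k (g m k)‖ ^ 2

theorem two_mul_re_star_mul_sub_le (z w : ℂ) :
    2 * (star w * z).re - ‖z‖ ^ 2 ≤ ‖w‖ ^ 2 := by
  have h := norm_sq_add_smul w z (-1)
  rw [inner_complex_eq_star_mul] at h
  have h2 : (star z * w).re = (star w * z).re := by simp; ring
  rw [h2] at h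
  nlinarith [sq_nonneg ‖w + (-1 : ℝ) • z‖]

theorem two_mul_re_star_mul_self_sub (z : ℂ) : 2 * (star z * z).re - ‖z‖ ^ 2 = ‖z‖ ^ 2 := by
  have h : (star z * z).re = ‖z‖ ^ 2 := by
    rw [← Complex.normSq_eq_norm_sq, Complex.normSq_apply]; simp
  rw [h]; ring

theorem signalLin_le (g f : Beams M K Nt) (m : Fin M) (k : Fin K) :
    S.signalLin g f m k ≤ ‖S.rx m m k (f m k)‖ ^ 2 := two_mul_re_star_mul_sub_le _ _

theorem signalLin_self (f : Beams M K Nt) (m : Fin M) (k : Fin K) :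
    S.signalLin f f m k = ‖S.rx m m k (f m k)‖ ^ 2 := two_mul_re_star_mul_self_sub _

theorem illumLin_eq_sum (g f : Beams M K Nt) (m : Fin M) :
    S.illumLin g f m =
      ∑ k, (2 * (star (S.tx m (f m k)) * S.tx m (g m k)).re - ‖S.tx m (g m k)‖ ^ 2) := by
  rw [illumLin, illum, Complex.re_sum, Finset.mul_sum, Finset.sum_sub_distrib]

theorem illumLin_le (g f : Beams M K Nt) (m : Fin M) : S.illumLin g f m ≤ S.illum f m := by
  rw [illumLin_eq_sum]
  exact Finset.sum_le_sum fun k _ => two_mul_re_star_mul_sub_le _ _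

theorem illumLin_self (f : Beams M K Nt) : S.illumLin f f = S.illum f := by
  funext m
  rw [illumLin_eq_sum]
  exact Finset.sum_congr rfl fun k _ => two_mul_re_star_mul_self_sub _

theorem illum_nonneg (f : Beams M K Nt) (m : Fin M) : 0 ≤ S.illum f m :=
  Finset.sum_nonneg fun _ _ => by positivity

theorem interference_nonneg (f : Beams M K Nt) (m : Fin M) (k : Fin K) :
    0 ≤ S.interference f m k :=
  Finset.sum_nonneg fun p _ => by split_ifs <;> positivity

theorem continuous_power (m : Fin M) : Continuous fun f : Beams M K Nt => power f m := by
  unfold power; fun_prop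

theorem continuous_illum : Continuous (S.illum : Beams M K Nt → Fin M → ℝ) := by
  unfold illum; fun_prop

theorem continuous_interference (m : Fin M) (k : Fin K) :
    Continuous fun f : Beams M K Nt => S.interference f m k := by
  unfold interference
  refine continuous_finsetSum _ fun p _ => ?_
  split_ifs
  · exact continuous_const
  · fun_prop

theorem continuous_signalLin_right (g : Beams M K Nt) (m : Fin M) (k : Fin K) :
    Continuous fun f : Beams M K Nt => S.signalLin g f m k := by
  unfold signalLin
  fun_prop

theorem continuous_signalLin_left (f : Beams M K Nt) (m : Fin M) (k : Fin K) :
    Continuous fun g : Beams M K Nt => S.signalLin g f m k := by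
  unfold signalLin
  fun_prop

theorem continuous_illumLin_right (g : Beams M K Nt) :
    Continuous fun f : Beams M K Nt => S.illumLin g f := by
  unfold illumLin
  fun_prop

theorem continuous_illumLin_left (f : Beams M K Nt) :
    Continuous fun g : Beams M K Nt => S.illumLin g f := by
  unfold illumLin
  have := S.continuous_illum (K := K)
  fun_prop

/-! ### Derivatives along lines -/

theorem differentiableAt_norm_rx_sq (i m : Fin M) (k : Fin K) (a : Fin M) (b : Fin K)
    (f : Beams M K Nt) :
    DifferentiableAt ℝ (fun f : Beams M K Nt => ‖S.rx i m k (f a b)‖ ^ 2) f := by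
  simp only [← rxCLM_apply]
  refine DifferentiableAt.norm_sq ℝ ?_
  fun_prop

theorem differentiableAt_interference (m : Fin M) (k : Fin K) (f : Beams M K Nt) :
    DifferentiableAt ℝ (fun f : Beams M K Nt => S.interference f m k) f := by
  unfold interference
  refine DifferentiableAt.fun_sum fun p _ => ?_
  split_ifs
  · exact differentiableAt_const _
  · exact S.differentiableAt_norm_rx_sq _ _ _ _ _ f

theorem differentiableAt_sinr (hσ : 0 < S.σn) (m : Fin M) (k : Fin K) (f : Beams M K Nt) :
    DifferentiableAt ℝ (fun f : Beams M K Nt => S.sinr f m k) f := by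
  unfold sinr
  have h := S.interference_nonneg f m k
  have hne : S.interference f m k + S.σn ^ 2 ≠ 0 := by positivity
  simpa only [div_eq_mul_inv] using (S.differentiableAt_norm_rx_sq m m k m k f).fun_mul
    (((S.differentiableAt_interference m k f).add_const _).fun_inv hne)

theorem differentiableAt_power (m : Fin M) (f : Beams M K Nt) :
    DifferentiableAt ℝ (fun f : Beams M K Nt => power f m) f := by
  unfold power
  refine DifferentiableAt.fun_sum fun k _ => DifferentiableAt.norm_sq ℂ ?_
  fun_prop

theorem differentiableAt_illum (f : Beams M K Nt) :
    DifferentiableAt ℝ (S.illum : Beams M K Nt → Fin M → ℝ) f := by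
  rw [differentiableAt_pi]
  intro m
  unfold illum
  refine DifferentiableAt.fun_sum fun k _ => ?_
  simp only [← txCLM_apply]
  refine DifferentiableAt.norm_sq ℝ ?_
  fun_prop

/-- The derivative of the transmit power at `f` in the direction `d`. -/
def powerSlope (f d : Beams M K Nt) (m : Fin M) : ℝ := ∑ k, 2 * (inner ℂ (d m k) (f m k)).re

/-- The derivative of the illumination at `f` in the direction `d`. -/
def illumSlope (f d : Beams M K Nt) (m : Fin M) : ℝ :=
  ∑ k, 2 * (star (S.tx m (d m k)) * S.tx m (f m k)).re

/-- The derivative of the signal power at `f` in the direction `d`. -/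
def signalSlope (f d : Beams M K Nt) (m : Fin M) (k : Fin K) : ℝ :=
  2 * (star (S.rx m m k (d m k)) * S.rx m m k (f m k)).re

/-- The derivative of the interference at `f` in the direction `d`. -/
def interferenceSlope (f d : Beams M K Nt) (m : Fin M) (k : Fin K) : ℝ :=
  fderiv ℝ (fun f : Beams M K Nt => S.interference f m k) f d

/-- The derivative of the SINR at `f` in the direction `d`. -/
def sinrSlope (f d : Beams M K Nt) (m : Fin M) (k : Fin K) : ℝ :=
  (S.signalSlope f d m k * (S.interference f m k + S.σn ^ 2) -
    ‖S.rx m m k (f m k)‖ ^ 2 * S.interferenceSlope f d m k) / (S.interference f m k + S.σn ^ 2) ^ 2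

theorem hasDerivAt_power (f d : Beams M K Nt) (m : Fin M) :
    HasDerivAt (fun t : ℝ => power (f + t • d) m) (powerSlope f d m) 0 :=
  HasDerivAt.fun_sum fun k _ => hasDerivAt_norm_sq_line (f m k) (d m k)

theorem hasDerivAt_illum (f d : Beams M K Nt) :
    HasDerivAt (fun t : ℝ => S.illum (f + t • d)) (S.illumSlope f d) 0 := by
  rw [hasDerivAt_pi]
  intro m
  refine HasDerivAt.fun_sum fun k _ => ?_
  have h := hasDerivAt_norm_sq_line (S.tx m (f m k)) (S.tx m (d m k))
  simp only [← tx_add_smul, inner_complex_eq_star_mul] at h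
  exact h

theorem hasDerivAt_signal (f d : Beams M K Nt) (m : Fin M) (k : Fin K) :
    HasDerivAt (fun t : ℝ => ‖S.rx m m k ((f + t • d) m k)‖ ^ 2) (S.signalSlope f d m k) 0 := by
  have h := hasDerivAt_norm_sq_line (S.rx m m k (f m k)) (S.rx m m k (d m k))
  simp only [← rx_add_smul, inner_complex_eq_star_mul] at h
  exact h

theorem hasDerivAt_interference (f d : Beams M K Nt) (m : Fin M) (k : Fin K) :
    HasDerivAt (fun t : ℝ => S.interference (f + t • d) m k) (S.interferenceSlope f d m k) 0 :=
  (S.differentiableAt_interference m k f).hasFDerivAt.hasLineDerivAt d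

theorem hasDerivAt_sinr (hσ : 0 < S.σn) (f d : Beams M K Nt) (m : Fin M) (k : Fin K) :
    HasDerivAt (fun t : ℝ => S.sinr (f + t • d) m k) (S.sinrSlope f d m k) 0 := by
  have h := S.interference_nonneg f m k
  have hne : S.interference (f + (0 : ℝ) • d) m k + S.σn ^ 2 ≠ 0 := by
    rw [zero_smul, add_zero]; positivity
  have h := (S.hasDerivAt_signal f d m k).fun_div
    ((S.hasDerivAt_interference f d m k).add_const (S.σn ^ 2)) hne
  simp only [zero_smul, add_zero] at h
  exact h

theorem illumLin_line (f d : Beams M K Nt) (t : ℝ) :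
    S.illumLin f (f + t • d) = S.illum f + t • S.illumSlope f d := by
  funext m
  have h := congrFun (S.illumLin_self f) m
  rw [illumLin_eq_sum] at h
  rw [Pi.add_apply, ← h, illumLin_eq_sum, Pi.smul_apply, illumSlope, smul_eq_mul, Finset.mul_sum,
    ← Finset.sum_add_distrib]
  refine Finset.sum_congr rfl fun k _ => ?_
  have : (f + t • d) m k = f m k + t • d m k := rfl
  rw [this, tx_add_smul]
  simp
  ring

theorem signalLin_line (f d : Beams M K Nt) (m : Fin M) (k : Fin K) (t : ℝ) :
    S.signalLin f (f + t • d) m k = ‖S.rx m m k (f m k)‖ ^ 2 + t * S.signalSlope f d m k := by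
  have : (f + t • d) m k = f m k + t • d m k := rfl
  rw [← signalLin_self, signalLin, signalLin, signalSlope, this, rx_add_smul]
  simp
  ring

theorem hasDerivAt_illumLin (f d : Beams M K Nt) :
    HasDerivAt (fun t : ℝ => S.illumLin f (f + t • d)) (S.illumSlope f d) 0 := by
  simp only [illumLin_line]
  simpa using ((hasDerivAt_id (0 : ℝ)).smul_const (S.illumSlope f d)).const_add (S.illum f)

theorem hasDerivAt_signalLin (f d : Beams M K Nt) (m : Fin M) (k : Fin K) :
    HasDerivAt (fun t : ℝ => S.signalLin f (f + t • d) m k) (S.signalSlope f d m k) 0 := by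
  simp only [signalLin_line]
  simpa using ((hasDerivAt_id (0 : ℝ)).mul_const (S.signalSlope f d m k)).const_add
    (‖S.rx m m k (f m k)‖ ^ 2)

/-! ### The constraints of the max–min problem -/

section CommProblem

variable (ε : ℝ) (f d : Beams M K Nt) (t τ : ℝ)

theorem differentiableAt_obj : DifferentiableAt ℝ (S.commProblem (K := K) ε).obj (f, t) :=
  differentiableAt_snd

theorem differentiableAt_con_sinr (hσ : 0 < S.σn) (p : Fin M × Fin K) :
    DifferentiableAt ℝ ((S.commProblem (K := K) ε).con (Sum.inl p)) (f, t) := by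
  have h : DifferentiableAt ℝ (fun x : Beams M K Nt × ℝ => S.sinr x.1 p.1 p.2) (f, t) :=
    DifferentiableAt.comp (g := fun f : Beams M K Nt => S.sinr f p.1 p.2) (f, t)
      (S.differentiableAt_sinr hσ p.1 p.2 f) differentiableAt_fst
  exact differentiableAt_snd.sub h

theorem differentiableAt_con_power (m : Fin M) :
    DifferentiableAt ℝ ((S.commProblem (K := K) ε).con (Sum.inr (Sum.inl m))) (f, t) := by
  have h : DifferentiableAt ℝ (fun x : Beams M K Nt × ℝ => power x.1 m) (f, t) :=
    DifferentiableAt.comp (g := fun f : Beams M K Nt => power f m) (f, t)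
      (differentiableAt_power m f) differentiableAt_fst
  exact h.sub_const _

theorem differentiableAt_con_crlb (hf : (S.fisher (S.illum f)).PosDef) (o : Unit) :
    DifferentiableAt ℝ ((S.commProblem (K := K) ε).con (Sum.inr (Sum.inr o))) (f, t) := by
  have h : DifferentiableAt ℝ (fun x : Beams M K Nt × ℝ => S.crlb (S.illum x.1)) (f, t) :=
    DifferentiableAt.comp (g := fun f : Beams M K Nt => S.crlb (S.illum f)) (f, t)
      ((S.differentiableAt_crlb hf).comp f (S.differentiableAt_illum f))
      differentiableAt_fst
  exact h.sub_const _

theorem fderiv_obj : fderiv ℝ (S.commProblem (K := K) ε).obj (f, t) (d, τ) = τ := by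
  have : (S.commProblem (K := K) ε).obj = Prod.snd := rfl
  rw [this, fderiv_snd]
  rfl

theorem fderiv_con_sinr (hσ : 0 < S.σn) (p : Fin M × Fin K) :
    fderiv ℝ ((S.commProblem (K := K) ε).con (Sum.inl p)) (f, t) (d, τ) =
      τ - S.sinrSlope f d p.1 p.2 := by
  refine fderiv_apply_eq_of_hasDerivAt (S.differentiableAt_con_sinr ε f t hσ p) ?_
  have h := (((hasDerivAt_id (0 : ℝ)).mul_const τ).const_add t).fun_sub
    (S.hasDerivAt_sinr hσ f d p.1 p.2)
  rw [one_mul] at h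
  exact h

theorem fderiv_con_power (m : Fin M) :
    fderiv ℝ ((S.commProblem (K := K) ε).con (Sum.inr (Sum.inl m))) (f, t) (d, τ) =
      powerSlope f d m :=
  fderiv_apply_eq_of_hasDerivAt (S.differentiableAt_con_power ε f t m)
    ((hasDerivAt_power f d m).sub_const _)

theorem fderiv_con_crlb (hf : (S.fisher (S.illum f)).PosDef) (o : Unit) :
    fderiv ℝ ((S.commProblem (K := K) ε).con (Sum.inr (Sum.inr o))) (f, t) (d, τ) =
      S.crlbSlope (S.illum f) (S.illumSlope f d) := by
  refine fderiv_apply_eq_of_hasDerivAt (S.differentiableAt_con_crlb ε f t hf o) ?_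
  have h := S.hasDerivAt_crlb_comp (S.hasDerivAt_illum f d)
    (by rw [zero_smul, add_zero]; exact hf)
  rw [zero_smul, add_zero] at h
  exact h.sub_const _

end CommProblem

end ISACSystem

namespace ISACSystem

variable {M K Nt N : ℕ} (S : ISACSystem M K Nt N)

/-! ### The surrogate problem in the beamformers alone -/

/-- The value `2 s ρ - s² u`, `s = ρ⁽ʳ⁾ / u⁽ʳ⁾`, of the surrogate of `SINR_{m,k}` once the auxiliary
variables have been optimized for given beamformers `f`: `ρ = ±√(signalLin)` and
`u = σn² + ω(f)`. -/
def surrogateSinr (z : SCAState M K Nt) (f : Beams M K Nt) (m : Fin M) (k : Fin K) : ℝ :=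
  2 * |z.ρ m k / z.u m k| * √(S.signalLin z.f f m k) -
    (z.ρ m k / z.u m k) ^ 2 * (S.σn ^ 2 + S.interference f m k)

/-- The beamformers that can be completed to a feasible point of the surrogate problem at `z`. -/
structure SurrogateDomain (ε : ℝ) (z : SCAState M K Nt) (f : Beams M K Nt) : Prop where
  power_le : ∀ m, power f m ≤ S.P
  crlb_le : S.CrlbLe ε (S.illumLin z.f f)
  signal_nonneg : ∀ m k, 0 ≤ S.signalLin z.f f m k

variable {S} {ε : ℝ} {z y : SCAState M K Nt}

theorem SurrogateFeasible.surrogateDomain (hw : ∀ p, 0 ≤ S.weight p) {q : Fin M → ℝ} {ϖ : ℝ}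
    (h : S.SurrogateFeasible ε z y q ϖ) : S.SurrogateDomain ε z y.f :=
  ⟨h.power_le, h.crlb_le.mono hw h.illum_ge, fun m k => (sq_nonneg _).trans (h.signal_ge m k)⟩

theorem SurrogateFeasible.le_surrogateSinr {q : Fin M → ℝ} {ϖ : ℝ}
    (h : S.SurrogateFeasible ε z y q ϖ) (m : Fin M) (k : Fin K) :
    ϖ ≤ S.surrogateSinr z y.f m k := by
  refine (h.ratio_ge m k).trans ?_
  rw [surrogateSinr, mul_div_assoc, ← div_pow]
  have h1 : z.ρ m k / z.u m k * y.ρ m k ≤ |z.ρ m k / z.u m k| * √(S.signalLin z.f y.f m k) := by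
    refine (le_abs_self _).trans ?_
    rw [abs_mul]
    exact mul_le_mul_of_nonneg_left (Real.abs_le_sqrt (h.signal_ge m k)) (abs_nonneg _)
  have h2 := mul_le_mul_of_nonneg_left (h.interference_le m k) (sq_nonneg (z.ρ m k / z.u m k))
  linarith

theorem SurrogateDomain.exists_surrogateFeasible {f : Beams M K Nt}
    (h : S.SurrogateDomain ε z f) {ϖ : ℝ} (hϖ : ∀ m k, ϖ ≤ S.surrogateSinr z f m k) :
    ∃ ρ u, S.SurrogateFeasible ε z ⟨f, ρ, u⟩ (S.illumLin z.f f) ϖ := by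
  refine ⟨fun m k => if 0 ≤ z.ρ m k / z.u m k then √(S.signalLin z.f f m k)
      else -√(S.signalLin z.f f m k), fun m k => S.σn ^ 2 + S.interference f m k,
    ⟨h.power_le, fun m => le_rfl, fun m k => ?_, fun m k => le_rfl, h.crlb_le, fun m k => ?_⟩⟩
  · refine le_of_eq ?_
    dsimp only
    split_ifs
    · rw [Real.sq_sqrt (h.signal_nonneg m k)]; rfl
    · rw [neg_sq, Real.sq_sqrt (h.signal_nonneg m k)]; rfl
  · refine (hϖ m k).trans (le_of_eq ?_)
    dsimp only
    rw [surrogateSinr, mul_div_assoc, ← div_pow]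
    split_ifs with hs
    · rw [abs_of_nonneg hs]
    · rw [abs_of_neg (not_le.1 hs)]; ring

theorem norm_le_sqrt_of_power_le {f : Beams M K Nt} {P : ℝ} (h : ∀ m, power f m ≤ P) :
    ‖f‖ ≤ √P := by
  refine (pi_norm_le_iff_of_nonneg (Real.sqrt_nonneg _)).2 fun m =>
    (pi_norm_le_iff_of_nonneg (Real.sqrt_nonneg _)).2 fun k => Real.le_sqrt_of_sq_le ?_
  exact (Finset.single_le_sum (f := fun k => ‖f m k‖ ^ 2) (fun _ _ => sq_nonneg _)
    (Finset.mem_univ k)).trans (h m)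

theorem isCompact_surrogateDomain (ε : ℝ) (z : SCAState M K Nt) :
    IsCompact {f | S.SurrogateDomain ε z f} := by
  have hset : {f | S.SurrogateDomain ε z f} = {f | (∀ m, power f m ≤ S.P) ∧
      S.CrlbLe ε (S.illumLin z.f f) ∧ ∀ m k, 0 ≤ S.signalLin z.f f m k} :=
    Set.ext fun f => ⟨fun h => ⟨h.1, h.2, h.3⟩, fun h => ⟨h.1, h.2.1, h.2.2⟩⟩
  refine Metric.isCompact_of_isClosed_isBounded ?_ ?_
  · rw [hset]
    refine IsClosed.and ?_ (IsClosed.and ?_ ?_)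
    · simp only [Set.ofPred_forall]
      exact isClosed_iInter fun m => isClosed_le (continuous_power m) continuous_const
    · exact (S.isClosed_crlbLe ε).preimage (S.continuous_illumLin_right z.f)
    · simp only [Set.ofPred_forall]
      exact isClosed_iInter fun m => isClosed_iInter fun k => isClosed_le continuous_const
        (S.continuous_signalLin_right z.f m k)
  · exact isBounded_iff_forall_norm_le.2 ⟨√S.P, fun f hf => norm_le_sqrt_of_power_le hf.power_le⟩

/-- The surrogate problem has an optimal solution as soon as it is feasible. -/
theorem exists_surrogateOptimal [Nonempty (Fin M × Fin K)] (hw : ∀ p, 0 ≤ S.weight p)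
    {f₀ : Beams M K Nt} (h₀ : S.SurrogateDomain ε z f₀) :
    ∃ y q ϖ, S.SurrogateOptimal ε z y q ϖ := by
  have hcont : Continuous fun f : Beams M K Nt =>
      Finset.univ.inf' Finset.univ_nonempty fun p : Fin M × Fin K =>
        S.surrogateSinr z f p.1 p.2 := by
    refine Continuous.finset_inf'_apply _ fun p _ => ?_
    unfold surrogateSinr
    have h1 := S.continuous_signalLin_right z.f p.1 p.2
    have h2 := S.continuous_interference p.1 p.2
    exact (continuous_const.mul (Real.continuous_sqrt.comp h1)).sub
      (continuous_const.mul (continuous_const.add h2))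
  obtain ⟨f, hf, hmax⟩ := (isCompact_surrogateDomain ε z).exists_isMaxOn ⟨f₀, h₀⟩
    hcont.continuousOn
  obtain ⟨ρ, u, hfeas⟩ := SurrogateDomain.exists_surrogateFeasible hf
    (ϖ := Finset.univ.inf' Finset.univ_nonempty fun p : Fin M × Fin K =>
        S.surrogateSinr z f p.1 p.2)
    fun m k => Finset.inf'_le (fun p : Fin M × Fin K => S.surrogateSinr z f p.1 p.2)
      (Finset.mem_univ (m, k))
  refine ⟨_, _, _, hfeas, fun y' q' ϖ' h' => ?_⟩
  exact (Finset.le_inf' _ _ fun p _ => h'.le_surrogateSinr p.1 p.2).trans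
    (hmax (h'.surrogateDomain hw))

/-- If the surrogate problem at `z` can be completed at `f`, its optimal value is at least any
common lower bound of the surrogate SINRs at `f`. -/
theorem SurrogateOptimal.le_of_domain {q : Fin M → ℝ} {ϖ : ℝ}
    (h : S.SurrogateOptimal ε z y q ϖ) {f : Beams M K Nt} (hf : S.SurrogateDomain ε z f) {v : ℝ}
    (hv : ∀ m k, v ≤ S.surrogateSinr z f m k) : v ≤ ϖ := by
  obtain ⟨ρ, u, hfeas⟩ := hf.exists_surrogateFeasible hv
  exact h.2 _ _ _ hfeas

end ISACSystem

namespace ISACSystem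

variable {M K Nt N : ℕ} {S : ISACSystem M K Nt N} {ε : ℝ} {z y : SCAState M K Nt}

/-! ### One iteration of the algorithm -/

theorem Feasible.weight_nonneg {f : Beams M K Nt} (h : S.Feasible ε f) (p : Fin M × Fin N) :
    0 ≤ S.weight p :=
  weight_nonneg_of_posDef (S.illum_nonneg f) h.2.1 p

theorem Feasible.nonempty {f : Beams M K Nt} (h : S.Feasible ε f) : Nonempty (Fin M × Fin K) := by
  by_contra hne
  rw [not_nonempty_iff] at hne
  -- without users nothing illuminates the target and the Fisher matrix vanishes
  have h0 := h.2.1.diag_pos (i := 0)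
  rw [fisher_apply, fisherForm_apply] at h0
  refine h0.ne' (Finset.sum_eq_zero fun p _ => ?_)
  have : S.illum f p.1 = 0 := Finset.sum_eq_zero fun k _ => (hne.false (p.1, k)).elim
  rw [this, mul_zero]

theorem IsInitial.u_pos (hσ : 0 < S.σn) (hz : S.IsInitial ε z) (m : Fin M) (k : Fin K) :
    0 < z.u m k := by
  have h1 := hz.interference m k
  have h2 := S.interference_nonneg z.f m k
  have h3 : 0 < S.σn ^ 2 := by positivity
  linarith

theorem IsInitial.surrogateDomain (hz : S.IsInitial ε z) : S.SurrogateDomain ε z z.f :=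
  ⟨hz.feasible.1, by rw [illumLin_self]; exact hz.feasible.2,
    fun m k => by rw [signalLin_self]; positivity⟩

/-- With `s = ρ / u`, the surrogate SINR at the point of expansion is at least `ρ² / u`. -/
theorem sq_div_le_surrogateSinr_self (m : Fin M) (k : Fin K) (hu : 0 < z.u m k)
    (hs : (z.ρ m k) ^ 2 ≤ ‖S.rx m m k (z.f m k)‖ ^ 2)
    (hi : S.σn ^ 2 + S.interference z.f m k ≤ z.u m k) :
    (z.ρ m k) ^ 2 / z.u m k ≤ S.surrogateSinr z z.f m k := by
  rw [surrogateSinr, signalLin_self, Real.sqrt_sq (norm_nonneg _)]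
  have h1 : |z.ρ m k| ≤ ‖S.rx m m k (z.f m k)‖ := abs_le_of_sq_le_sq hs (norm_nonneg _)
  have h2 := mul_le_mul_of_nonneg_left h1 (abs_nonneg (z.ρ m k / z.u m k))
  have h3 := mul_le_mul_of_nonneg_left hi (sq_nonneg (z.ρ m k / z.u m k))
  have h4 : |z.ρ m k / z.u m k| * |z.ρ m k| = (z.ρ m k) ^ 2 / z.u m k := by
    rw [← abs_mul, div_mul_eq_mul_div, ← sq, abs_of_nonneg (by positivity)]
  have h5 : (z.ρ m k / z.u m k) ^ 2 * z.u m k = (z.ρ m k) ^ 2 / z.u m k := by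
    field_simp
  linarith

theorem SurrogateFeasible.u_pos (hσ : 0 < S.σn) {q : Fin M → ℝ} {ϖ : ℝ}
    (h : S.SurrogateFeasible ε z y q ϖ) (m : Fin M) (k : Fin K) : 0 < y.u m k := by
  have h1 := h.interference_le m k
  have h2 := S.interference_nonneg y.f m k
  have h3 : 0 < S.σn ^ 2 := by positivity
  linarith

theorem SurrogateFeasible.le_sq_div (hσ : 0 < S.σn) {q : Fin M → ℝ} {ϖ : ℝ}
    (h : S.SurrogateFeasible ε z y q ϖ) (m : Fin M) (k : Fin K) :
    ϖ ≤ (y.ρ m k) ^ 2 / y.u m k := by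
  have hu := h.u_pos hσ m k
  refine (h.ratio_ge m k).trans ?_
  rw [mul_div_assoc, ← div_pow, le_div_iff₀ hu]
  nlinarith [sq_nonneg (y.ρ m k - z.ρ m k / z.u m k * y.u m k)]

theorem SurrogateOptimal.le_of_le_sq_div (hσ : 0 < S.σn) {q : Fin M → ℝ} {ϖ : ℝ}
    (hz : S.IsInitial ε z) (h : S.SurrogateOptimal ε z y q ϖ) {v : ℝ}
    (hv : ∀ m k, v ≤ (z.ρ m k) ^ 2 / z.u m k) : v ≤ ϖ :=
  h.le_of_domain hz.surrogateDomain fun m k => (hv m k).trans <|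
    sq_div_le_surrogateSinr_self m k (hz.u_pos hσ m k) (hz.signal m k) (hz.interference m k)

theorem SurrogateOptimal.pos (hσ : 0 < S.σn) {q : Fin M → ℝ} {ϖ : ℝ}
    (hz : S.IsInitial ε z) (h : S.SurrogateOptimal ε z y q ϖ) : 0 < ϖ := by
  have := hz.feasible.nonempty
  refine lt_of_lt_of_le (b := Finset.univ.inf' Finset.univ_nonempty fun p : Fin M × Fin K =>
    (z.ρ p.1 p.2) ^ 2 / z.u p.1 p.2) ?_ (h.le_of_le_sq_div hσ hz fun m k => ?_)
  · rw [Finset.lt_inf'_iff]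
    exact fun p _ => div_pos (sq_pos_iff.2 (hz.rho_ne p.1 p.2)) (hz.u_pos hσ _ _)
  · exact Finset.inf'_le (fun p : Fin M × Fin K => (z.ρ p.1 p.2) ^ 2 / z.u p.1 p.2)
      (Finset.mem_univ (m, k))

/-- An iteration turns admissible states into admissible states. -/
theorem SurrogateOptimal.isInitial (hσ : 0 < S.σn) {q : Fin M → ℝ} {ϖ : ℝ}
    (hz : S.IsInitial ε z) (h : S.SurrogateOptimal ε z y q ϖ) : S.IsInitial ε y where
  feasible := ⟨h.1.power_le, h.1.crlb_le.mono hz.feasible.weight_nonneg fun m =>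
    (h.1.illum_ge m).trans (S.illumLin_le _ _ m)⟩
  signal m k := (h.1.signal_ge m k).trans (S.signalLin_le _ _ m k)
  interference := h.1.interference_le
  rho_ne m k h0 := by
    have h1 := (h.pos hσ hz).trans_le (h.1.le_sq_div hσ m k)
    simp [h0] at h1

theorem exists_isRun (hσ : 0 < S.σn) (hz : S.IsInitial ε z) :
    ∃ Z q ϖ, S.IsRun ε Z q ϖ ∧ Z 0 = z := by
  have hstep : ∀ x : {x : SCAState M K Nt // S.IsInitial ε x}, ∃ x' : {x // S.IsInitial ε x},
      ∃ q ϖ, S.SurrogateOptimal ε x.1 x'.1 q ϖ := by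
    rintro ⟨x, hx⟩
    have := hx.feasible.nonempty
    obtain ⟨y, q, ϖ, h⟩ := exists_surrogateOptimal hx.feasible.weight_nonneg hx.surrogateDomain
    exact ⟨⟨y, h.isInitial hσ hx⟩, q, ϖ, h⟩
  choose next q ϖ hopt using hstep
  let Z : ℕ → {x : SCAState M K Nt // S.IsInitial ε x} := fun r => next^[r] ⟨z, hz⟩
  refine ⟨fun r => (Z r).1, fun r => q (Z r), fun r => ϖ (Z r), ⟨hz, fun r => ?_⟩, rfl⟩
  have : Z (r + 1) = next (Z r) := Function.iterate_succ_apply' _ _ _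
  dsimp only
  rw [this]
  exact hopt (Z r)

/-! ### Runs of the algorithm -/

section Run

variable {Z : ℕ → SCAState M K Nt} {q : ℕ → Fin M → ℝ} {ϖ : ℕ → ℝ}

theorem IsRun.isInitial (hσ : 0 < S.σn) (h : S.IsRun ε Z q ϖ) (r : ℕ) : S.IsInitial ε (Z r) := by
  induction r with
  | zero => exact h.1
  | succ r ih => exact (h.2 r).isInitial hσ ih

theorem IsRun.monotone (hσ : 0 < S.σn) (h : S.IsRun ε Z q ϖ) : Monotone ϖ :=
  monotone_nat_of_le_succ fun r => (h.2 (r + 1)).le_of_le_sq_div hσ (h.isInitial hσ (r + 1))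
    fun m k => (h.2 r).1.le_sq_div hσ m k

theorem IsRun.isBounded (hσ : 0 < S.σn) (h : S.IsRun ε Z q ϖ) :
    Bornology.IsBounded (Set.range fun r => (Z r).f) := by
  refine isBounded_iff_forall_norm_le.2 ⟨√S.P, ?_⟩
  rintro _ ⟨r, rfl⟩
  exact norm_le_sqrt_of_power_le (h.isInitial hσ r).feasible.1

/-- The variables `ρ` along a run are uniformly bounded, by the power budgets. -/
theorem IsRun.exists_rho_sq_le (hσ : 0 < S.σn) (h : S.IsRun ε Z q ϖ) :
    ∃ B : ℝ, ∀ (r : ℕ) (m : Fin M) (k : Fin K), ((Z r).ρ m k) ^ 2 ≤ B := by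
  refine ⟨∑ p : Fin M × Fin K, ‖S.h p.1 p.1 p.2‖ ^ 2 * S.P, fun r m k => ?_⟩
  have hz := h.isInitial hσ r
  have hf : ‖(Z r).f m k‖ ^ 2 ≤ S.P := (Finset.single_le_sum (f := fun k => ‖(Z r).f m k‖ ^ 2)
    (fun _ _ => sq_nonneg _) (Finset.mem_univ k)).trans (hz.feasible.1 m)
  have hP : 0 ≤ S.P := (sq_nonneg _).trans hf
  have hsum : ∀ p₀ : Fin M × Fin K, ‖S.h p₀.1 p₀.1 p₀.2‖ ^ 2 * S.P ≤
      ∑ p : Fin M × Fin K, ‖S.h p.1 p.1 p.2‖ ^ 2 * S.P := fun p₀ =>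
    Finset.single_le_sum (f := fun p : Fin M × Fin K => ‖S.h p.1 p.1 p.2‖ ^ 2 * S.P)
      (fun _ _ => mul_nonneg (sq_nonneg _) hP) (Finset.mem_univ p₀)
  calc ((Z r).ρ m k) ^ 2 ≤ ‖S.rx m m k ((Z r).f m k)‖ ^ 2 := hz.signal m k
    _ ≤ (‖S.h m m k‖ * ‖(Z r).f m k‖) ^ 2 := by gcongr; exact norm_inner_le_norm _ _
    _ = ‖S.h m m k‖ ^ 2 * ‖(Z r).f m k‖ ^ 2 := mul_pow _ _ _
    _ ≤ ‖S.h m m k‖ ^ 2 * S.P := by gcongr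
    _ ≤ _ := hsum (m, k)

theorem IsRun.exists_tendsto (hσ : 0 < S.σn) (h : S.IsRun ε Z q ϖ) :
    ∃ L, Tendsto ϖ atTop (𝓝 L) := by
  obtain ⟨B, hB⟩ := h.exists_rho_sq_le hσ
  obtain ⟨p⟩ := h.1.feasible.nonempty
  refine ⟨_, tendsto_atTop_ciSup (h.monotone hσ) ⟨B / S.σn ^ 2, ?_⟩⟩
  rintro _ ⟨r, rfl⟩
  have hB0 : 0 ≤ B := (sq_nonneg _).trans (hB 0 p.1 p.2)
  have hu : S.σn ^ 2 ≤ (Z (r + 1)).u p.1 p.2 :=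
    (le_add_of_nonneg_right (S.interference_nonneg _ _ _)).trans
      ((h.2 r).1.interference_le p.1 p.2)
  exact ((h.2 r).1.le_sq_div hσ p.1 p.2).trans (div_le_div₀ hB0 (hB _ _ _) (by positivity) hu)

theorem IsRun.exists_accumulationPoint (hσ : 0 < S.σn) (h : S.IsRun ε Z q ϖ) :
    ∃ fs, IsAccumulationPoint Z fs := by
  obtain ⟨a, -, φ, hφ, hlim⟩ := tendsto_subseq_of_bounded (h.isBounded hσ)
    (x := fun r => (Z r).f) fun n => ⟨n, rfl⟩
  exact ⟨a, hlim.mapClusterPt.of_comp hφ.tendsto_atTop⟩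

/-- Along a subsequence on which the beamformers converge to an accumulation point, the auxiliary
variables can be made to converge too. They remain bounded although no constraint bounds `u`:
`u ≤ ρ² / ϖ`. -/
theorem IsRun.exists_subseq (hσ : 0 < S.σn) (h : S.IsRun ε Z q ϖ) {fs : Beams M K Nt}
    (hfs : IsAccumulationPoint Z fs) :
    ∃ zs : SCAState M K Nt, zs.f = fs ∧ ∃ φ : ℕ → ℕ, StrictMono φ ∧
      Tendsto (fun n => (Z (φ n)).f) atTop (𝓝 zs.f) ∧
      Tendsto (fun n => (Z (φ n)).ρ) atTop (𝓝 zs.ρ) ∧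
      Tendsto (fun n => (Z (φ n)).u) atTop (𝓝 zs.u) := by
  obtain ⟨φ, hφ, hlim⟩ := MapClusterPt.tendsto_subseq hfs
  obtain ⟨B, hB⟩ := h.exists_rho_sq_le hσ
  have hpos : 0 < ϖ 0 := (h.2 0).pos hσ h.1
  have hρ : ∀ r, ‖(Z r).ρ‖ ≤ √B := fun r =>
    (pi_norm_le_iff_of_nonneg (Real.sqrt_nonneg _)).2 fun m =>
      (pi_norm_le_iff_of_nonneg (Real.sqrt_nonneg _)).2 fun k => Real.abs_le_sqrt (hB r m k)
  obtain ⟨p⟩ := h.1.feasible.nonempty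
  have hB0 : 0 ≤ B := (sq_nonneg _).trans (hB 0 p.1 p.2)
  have hu : ∀ r, ‖(Z (r + 1)).u‖ ≤ B / ϖ 0 := fun r =>
    (pi_norm_le_iff_of_nonneg (by positivity)).2 fun m =>
      (pi_norm_le_iff_of_nonneg (by positivity)).2 fun k => by
        have hu0 := (h.2 r).1.u_pos hσ m k
        have h1 := (h.monotone hσ (Nat.zero_le r)).trans ((h.2 r).1.le_sq_div hσ m k)
        rw [Real.norm_eq_abs, abs_of_pos hu0, le_div_iff₀ hpos]
        rw [le_div_iff₀ hu0] at h1
        linarith [hB (r + 1) m k]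
  have hub : Bornology.IsBounded (Set.range fun n => ((Z (φ (n + 1))).ρ, (Z (φ (n + 1))).u)) := by
    refine isBounded_iff_forall_norm_le.2 ⟨max (√B) (B / ϖ 0), ?_⟩
    rintro _ ⟨n, rfl⟩
    have hn : φ (n + 1) = (φ (n + 1) - 1) + 1 := by
      have := hφ.id_le (n + 1)
      simp only [id] at this
      omega
    refine max_le_max (hρ _) ?_
    dsimp only
    rw [hn]
    exact hu _
  obtain ⟨a, -, ψ, hψ, hlim'⟩ := tendsto_subseq_of_bounded hub
    (x := fun n => ((Z (φ (n + 1))).ρ, (Z (φ (n + 1))).u)) fun n => ⟨n, rfl⟩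
  refine ⟨⟨fs, a.1, a.2⟩, rfl, fun n => φ (ψ n + 1),
    fun i j hij => hφ (Nat.succ_lt_succ (hψ hij)), ?_, ?_, ?_⟩
  · exact hlim.comp ((tendsto_add_atTop_nat 1).comp hψ.tendsto_atTop)
  · exact (continuous_fst.tendsto a).comp hlim'
  · exact (continuous_snd.tendsto a).comp hlim'

end Run

end ISACSystem

namespace ISACSystem

variable {M K Nt N : ℕ} {S : ISACSystem M K Nt N} {ε : ℝ}

/-! ### Accumulation points of a run -/

section Surrogate

variable {z : SCAState M K Nt} {m : Fin M} {k : Fin K}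

/-- The surrogate SINR exceeds `ρ² / u` at the point of expansion unless `ρ` and `u` are tight. -/
theorem tight_of_surrogateSinr_self_le (hu : 0 < z.u m k) (hρ : z.ρ m k ≠ 0)
    (hs : (z.ρ m k) ^ 2 ≤ ‖S.rx m m k (z.f m k)‖ ^ 2)
    (hi : S.σn ^ 2 + S.interference z.f m k ≤ z.u m k)
    (h : S.surrogateSinr z z.f m k ≤ (z.ρ m k) ^ 2 / z.u m k) :
    |z.ρ m k| = ‖S.rx m m k (z.f m k)‖ ∧ z.u m k = S.interference z.f m k + S.σn ^ 2 := by
  rw [surrogateSinr, signalLin_self, Real.sqrt_sq (norm_nonneg _)] at h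
  have hs0 : z.ρ m k / z.u m k ≠ 0 := div_ne_zero hρ hu.ne'
  have h1 : |z.ρ m k| ≤ ‖S.rx m m k (z.f m k)‖ := abs_le_of_sq_le_sq hs (norm_nonneg _)
  have h2 := mul_nonneg (abs_nonneg (z.ρ m k / z.u m k)) (sub_nonneg.2 h1)
  have h3 := mul_nonneg (sq_nonneg (z.ρ m k / z.u m k)) (sub_nonneg.2 hi)
  have h4 : |z.ρ m k / z.u m k| * |z.ρ m k| = (z.ρ m k) ^ 2 / z.u m k := by
    rw [← abs_mul, div_mul_eq_mul_div, ← sq, abs_of_nonneg (by positivity)]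
  have h5 : (z.ρ m k / z.u m k) ^ 2 * z.u m k = (z.ρ m k) ^ 2 / z.u m k := by
    field_simp
  have h6 : |z.ρ m k / z.u m k| * (‖S.rx m m k (z.f m k)‖ - |z.ρ m k|) = 0 := by linarith
  have h7 : (z.ρ m k / z.u m k) ^ 2 * (z.u m k - (S.σn ^ 2 + S.interference z.f m k)) = 0 := by
    linarith
  have h8 := (mul_eq_zero.1 h6).resolve_left (abs_ne_zero.2 hs0)
  have h9 := (mul_eq_zero.1 h7).resolve_left (pow_ne_zero 2 hs0)
  constructor <;> linarith

theorem hasDerivAt_surrogateSinr (d : Beams M K Nt) (hs : 0 < ‖S.rx m m k (z.f m k)‖) :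
    HasDerivAt (fun t : ℝ => S.surrogateSinr z (z.f + t • d) m k)
      (2 * |z.ρ m k / z.u m k| * (S.signalSlope z.f d m k / (2 * ‖S.rx m m k (z.f m k)‖)) -
        (z.ρ m k / z.u m k) ^ 2 * S.interferenceSlope z.f d m k) 0 := by
  have h1 := (S.hasDerivAt_signalLin z.f d m k).sqrt
    (by rw [zero_smul, add_zero, signalLin_self]; positivity)
  rw [zero_smul, add_zero, signalLin_self, Real.sqrt_sq (norm_nonneg _)] at h1
  exact (h1.const_mul _).fun_sub
    (((S.hasDerivAt_interference z.f d m k).const_add (S.σn ^ 2)).const_mul _)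

/-- For tight auxiliary variables the surrogate SINR is tangent to the SINR. -/
theorem surrogateSlope_eq_sinrSlope (d : Beams M K Nt) (hs : 0 < ‖S.rx m m k (z.f m k)‖)
    (hu : 0 < z.u m k) (hρ : |z.ρ m k| = ‖S.rx m m k (z.f m k)‖)
    (hi : z.u m k = S.interference z.f m k + S.σn ^ 2) :
    2 * |z.ρ m k / z.u m k| * (S.signalSlope z.f d m k / (2 * ‖S.rx m m k (z.f m k)‖)) -
        (z.ρ m k / z.u m k) ^ 2 * S.interferenceSlope z.f d m k = S.sinrSlope z.f d m k := by
  rw [sinrSlope, ← hi, ← sq_abs (z.ρ m k / z.u m k), abs_div, abs_of_pos hu, hρ]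
  field_simp

end Surrogate

/-- What remains of the constraints in the limit of a run: the state `z` is admissible, and its
value is at least the limit `L` of the optimal values. -/
structure IsLimitState (S : ISACSystem M K Nt N) (ε L : ℝ) (z : SCAState M K Nt) : Prop where
  isInitial : S.IsInitial ε z
  le_ratio : ∀ m k, L ≤ (z.ρ m k) ^ 2 / z.u m k

section Run

variable {Z : ℕ → SCAState M K Nt} {q : ℕ → Fin M → ℝ} {ϖ : ℕ → ℝ} {L : ℝ} {zs : SCAState M K Nt}
  {φ : ℕ → ℕ}

theorem isClosed_feasible (S : ISACSystem M K Nt N) (ε : ℝ) :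
    IsClosed {f : Beams M K Nt | S.Feasible ε f} := by
  refine IsClosed.and ?_ ((S.isClosed_crlbLe ε).preimage S.continuous_illum)
  simp only [Set.ofPred_forall]
  exact isClosed_iInter fun m => isClosed_le (continuous_power m) continuous_const

theorem IsRun.isLimitState (hσ : 0 < S.σn) (h : S.IsRun ε Z q ϖ) (hL : Tendsto ϖ atTop (𝓝 L))
    (hφ : StrictMono φ) (hf : Tendsto (fun n => (Z (φ n)).f) atTop (𝓝 zs.f))
    (hρ : Tendsto (fun n => (Z (φ n)).ρ) atTop (𝓝 zs.ρ))
    (hu : Tendsto (fun n => (Z (φ n)).u) atTop (𝓝 zs.u)) : S.IsLimitState ε L zs := by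
  have hρ' : ∀ m k, Tendsto (fun n => (Z (φ n)).ρ m k) atTop (𝓝 (zs.ρ m k)) := fun m k =>
    tendsto_pi_nhds.1 (tendsto_pi_nhds.1 hρ m) k
  have hu' : ∀ m k, Tendsto (fun n => (Z (φ n)).u m k) atTop (𝓝 (zs.u m k)) := fun m k =>
    tendsto_pi_nhds.1 (tendsto_pi_nhds.1 hu m) k
  have hint : ∀ m k, S.σn ^ 2 + S.interference zs.f m k ≤ zs.u m k := fun m k =>
    le_of_tendsto_of_tendsto ((((S.continuous_interference m k).tendsto _).comp hf).const_add _)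
      (hu' m k) (Eventually.of_forall fun n => (h.isInitial hσ (φ n)).interference m k)
  have hupos : ∀ m k, 0 < zs.u m k := fun m k => by
    have h1 := hint m k
    have h2 := S.interference_nonneg zs.f m k
    have h3 : 0 < S.σn ^ 2 := by positivity
    linarith
  -- the value of the state `Z (r + 1)` is at least `ϖ r`
  have hratio : ∀ m k, L ≤ (zs.ρ m k) ^ 2 / zs.u m k := fun m k => by
    refine le_of_tendsto_of_tendsto (hL.comp ((tendsto_sub_atTop_nat 1).comp hφ.tendsto_atTop))
      (((hρ' m k).pow 2).div (hu' m k) (hupos m k).ne') ?_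
    filter_upwards [hφ.tendsto_atTop.eventually_ge_atTop 1] with n hn
    have := (h.2 (φ n - 1)).1.le_sq_div hσ m k
    rwa [Nat.sub_add_cancel hn] at this
  have hLpos : 0 < L := ((h.2 0).pos hσ h.1).trans_le ((h.monotone hσ).ge_of_tendsto hL 0)
  refine ⟨⟨(isClosed_feasible S ε).mem_of_tendsto hf
    (Eventually.of_forall fun n => (h.isInitial hσ (φ n)).feasible), fun m k => ?_, hint,
    fun m k h0 => ?_⟩, hratio⟩
  · have hc : Continuous fun f : Beams M K Nt => ‖S.rx m m k (f m k)‖ ^ 2 := by fun_prop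
    exact le_of_tendsto_of_tendsto ((hρ' m k).pow 2) ((hc.tendsto _).comp hf)
      (Eventually.of_forall fun n => (h.isInitial hσ (φ n)).signal m k)
  · have := hLpos.trans_le (hratio m k)
    simp [h0] at this

/-- No point satisfying the constraints of the limiting surrogate problem strictly has a value
above `L`: it would be feasible, with a value above `L`, for the problems of the run close to the
limit. -/
theorem IsRun.exists_surrogateSinr_le (hσ : 0 < S.σn) (h : S.IsRun ε Z q ϖ)
    (hL : Tendsto ϖ atTop (𝓝 L)) (hf : Tendsto (fun n => (Z (φ n)).f) atTop (𝓝 zs.f))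
    (hρ : Tendsto (fun n => (Z (φ n)).ρ) atTop (𝓝 zs.ρ))
    (hu : Tendsto (fun n => (Z (φ n)).u) atTop (𝓝 zs.u)) (hz : S.IsLimitState ε L zs)
    {f : Beams M K Nt} (hpow : ∀ m, power f m ≤ S.P)
    (hpd : (S.fisher (S.illumLin zs.f f)).PosDef) (hcrlb : S.crlb (S.illumLin zs.f f) < ε)
    (hsig : ∀ m k, 0 < S.signalLin zs.f f m k) : ∃ m k, S.surrogateSinr zs f m k ≤ L := by
  by_contra! hval
  have := hz.isInitial.feasible.nonempty
  obtain ⟨v, hLv, hv⟩ : ∃ v, L < v ∧ ∀ m k, v < S.surrogateSinr zs f m k := by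
    have hlt : L < Finset.univ.inf' Finset.univ_nonempty fun p : Fin M × Fin K =>
        S.surrogateSinr zs f p.1 p.2 := (Finset.lt_inf'_iff _).2 fun p _ => hval p.1 p.2
    obtain ⟨v, hLv, hv⟩ := exists_between hlt
    have hv' : ∀ p : Fin M × Fin K, v < S.surrogateSinr zs f p.1 p.2 := fun p =>
      (Finset.lt_inf'_iff _).1 hv p (Finset.mem_univ p)
    exact ⟨v, hLv, fun m k => hv' (m, k)⟩
  have hill : Tendsto (fun n => S.illumLin (Z (φ n)).f f) atTop (𝓝 (S.illumLin zs.f f)) :=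
    ((S.continuous_illumLin_left f).tendsto zs.f).comp hf
  have hsl : ∀ m k, Tendsto (fun n => S.signalLin (Z (φ n)).f f m k) atTop
      (𝓝 (S.signalLin zs.f f m k)) := fun m k =>
    ((S.continuous_signalLin_left f m k).tendsto zs.f).comp hf
  have hratio : ∀ m k, Tendsto (fun n => (Z (φ n)).ρ m k / (Z (φ n)).u m k) atTop
      (𝓝 (zs.ρ m k / zs.u m k)) := fun m k =>
    (tendsto_pi_nhds.1 (tendsto_pi_nhds.1 hρ m) k).div
      (tendsto_pi_nhds.1 (tendsto_pi_nhds.1 hu m) k) (hz.isInitial.u_pos hσ m k).ne'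
  have hΦ : ∀ m k, Tendsto (fun n => S.surrogateSinr (Z (φ n)) f m k) atTop
      (𝓝 (S.surrogateSinr zs f m k)) := fun m k =>
    (((hratio m k).abs.const_mul 2).mul (hsl m k).sqrt).sub
      (((hratio m k).pow 2).mul_const _)
  have hev : ∀ᶠ n in atTop, (S.fisher (S.illumLin (Z (φ n)).f f)).PosDef ∧
      S.crlb (S.illumLin (Z (φ n)).f f) < ε ∧ (∀ m k, 0 < S.signalLin (Z (φ n)).f f m k) ∧
      ∀ m k, v < S.surrogateSinr (Z (φ n)) f m k := by
    refine (hill.eventually (S.isOpen_posDef_fisher.mem_nhds hpd)).and (.and ?_ (.and ?_ ?_))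
    · exact ((S.differentiableAt_crlb hpd).continuousAt.tendsto.comp hill).eventually_lt_const
        hcrlb
    · exact eventually_all.2 fun m => eventually_all.2 fun k =>
        (hsl m k).eventually_const_lt (hsig m k)
    · exact eventually_all.2 fun m => eventually_all.2 fun k =>
        (hΦ m k).eventually_const_lt (hv m k)
  obtain ⟨n, h1, h2, h3, h4⟩ := hev.exists
  have hle : v ≤ ϖ (φ n) := (h.2 (φ n)).le_of_domain ⟨hpow, ⟨h1, h2.le⟩, fun m k => (h3 m k).le⟩
    fun m k => (h4 m k).le
  linarith [(h.monotone hσ).ge_of_tendsto hL (φ n)]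

/-- The limiting beamformers admit no direction that strictly decreases the active power and CRLB
constraints and strictly increases all SINRs equal to `L`. -/
theorem IsRun.not_exists_direction (hσ : 0 < S.σn) (h : S.IsRun ε Z q ϖ)
    (hL : Tendsto ϖ atTop (𝓝 L)) (hf : Tendsto (fun n => (Z (φ n)).f) atTop (𝓝 zs.f))
    (hρ : Tendsto (fun n => (Z (φ n)).ρ) atTop (𝓝 zs.ρ))
    (hu : Tendsto (fun n => (Z (φ n)).u) atTop (𝓝 zs.u)) (hz : S.IsLimitState ε L zs)
    {d : Beams M K Nt} (hpow : ∀ m, power zs.f m = S.P → powerSlope zs.f d m < 0)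
    (hcrlb : S.crlb (S.illum zs.f) = ε →
      S.crlbSlope (S.illum zs.f) (S.illumSlope zs.f d) < 0)
    (hval : ∀ m k, S.sinr zs.f m k = L → 0 < S.sinrSlope zs.f d m k) : False := by
  have hi := hz.isInitial
  have hrx : ∀ m k, 0 < ‖S.rx m m k (zs.f m k)‖ := fun m k => by
    have h1 := (sq_pos_iff.2 (hi.rho_ne m k)).trans_le (hi.signal m k)
    exact (norm_nonneg _).lt_of_ne' fun h0 => by simp [h0] at h1
  have hpd := hi.feasible.2.1
  have hill0 : S.illumLin zs.f (zs.f + (0 : ℝ) • d) = S.illum zs.f := by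
    rw [zero_smul, add_zero, illumLin_self]
  have e1 : ∀ m, ∀ᶠ t : ℝ in 𝓝[>] 0, power (zs.f + t • d) m < S.P := fun m => by
    refine eventually_lt_of_hasDerivAt (hasDerivAt_power zs.f d m) ?_ ?_
    · rw [zero_smul, add_zero]; exact hi.feasible.1 m
    · rw [zero_smul, add_zero]; exact hpow m
  have hcont := (S.hasDerivAt_illumLin zs.f d).continuousAt
  have e2 : ∀ᶠ t : ℝ in 𝓝[>] 0, (S.fisher (S.illumLin zs.f (zs.f + t • d))).PosDef :=
    (hcont.eventually (S.isOpen_posDef_fisher.mem_nhds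
      (by dsimp only; rw [hill0]; exact hpd))).filter_mono
      nhdsWithin_le_nhds
  have e3 : ∀ᶠ t : ℝ in 𝓝[>] 0, S.crlb (S.illumLin zs.f (zs.f + t • d)) < ε := by
    refine eventually_lt_of_hasDerivAt (S.hasDerivAt_crlb_comp (S.hasDerivAt_illumLin zs.f d)
      (by rw [hill0]; exact hpd)) ?_ ?_
    · rw [hill0]; exact hi.feasible.2.2
    · rw [hill0]; exact hcrlb
  have e4 : ∀ m k, ∀ᶠ t : ℝ in 𝓝[>] 0, 0 < S.signalLin zs.f (zs.f + t • d) m k := fun m k =>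
    ((S.hasDerivAt_signalLin zs.f d m k).continuousAt.eventually (lt_mem_nhds (by
      dsimp only; rw [zero_smul, add_zero, signalLin_self]; exact pow_pos (hrx m k) 2))).filter_mono
      nhdsWithin_le_nhds
  have e5 : ∀ m k, ∀ᶠ t : ℝ in 𝓝[>] 0, -S.surrogateSinr zs (zs.f + t • d) m k < -L :=
    fun m k => by
    have hself := sq_div_le_surrogateSinr_self m k (hi.u_pos hσ m k) (hi.signal m k)
      (hi.interference m k)
    have hLr := hz.le_ratio m k
    refine eventually_lt_of_hasDerivAt (hasDerivAt_surrogateSinr d (hrx m k)).fun_neg ?_ ?_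
    · rw [zero_smul, add_zero]; linarith
    · rw [zero_smul, add_zero]
      intro heq
      obtain ⟨t1, t2⟩ := tight_of_surrogateSinr_self_le (hi.u_pos hσ m k) (hi.rho_ne m k)
        (hi.signal m k) (hi.interference m k) (by linarith)
      rw [surrogateSlope_eq_sinrSlope d (hrx m k) (hi.u_pos hσ m k) t1 t2, neg_lt_zero]
      refine hval m k ?_
      rw [sinr, ← t1, ← t2, sq_abs]
      linarith
  obtain ⟨t, h1, h2, h3, h4, h5⟩ := ((eventually_all.2 e1).and (e2.and (e3.and
    ((eventually_all.2 fun m => eventually_all.2 (e4 m)).and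
      (eventually_all.2 fun m => eventually_all.2 (e5 m)))))).exists
  obtain ⟨m, k, hmk⟩ := h.exists_surrogateSinr_le hσ hL hf hρ hu hz (fun m => (h1 m).le) h2 h3 h4
  linarith [h5 m k]

theorem minSinr_le (f : Beams M K Nt) (m : Fin M) (k : Fin K) : S.minSinr f ≤ S.sinr f m k :=
  ciInf_le (Set.finite_range _).bddBelow (m, k)

/-- Regular accumulation points are KKT points, at which the smallest SINR is the limit of the
optimal values. -/
theorem IsRun.isKKTPoint (hσ : 0 < S.σn) (h : S.IsRun ε Z q ϖ) (hL : Tendsto ϖ atTop (𝓝 L))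
    {fs : Beams M K Nt} (hfs : IsAccumulationPoint Z fs) (hreg : S.IsRegular ε fs) :
    S.IsKKTPoint ε fs ∧ S.minSinr fs = L := by
  obtain ⟨zs, rfl, φ, hφ, hf, hρ, hu⟩ := h.exists_subseq hσ hfs
  have hz := h.isLimitState hσ hL hφ hf hρ hu
  have hi := hz.isInitial
  have hpd := hi.feasible.2.1
  have := hi.feasible.nonempty
  have hLs : ∀ m k, L ≤ S.sinr zs.f m k := fun m k => (hz.le_ratio m k).trans <|
    div_le_div₀ (sq_nonneg _) (hi.signal m k)
      (by have := S.interference_nonneg zs.f m k; positivity)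
      (by linarith [hi.interference m k])
  have hLmin : L ≤ S.minSinr zs.f := le_ciInf fun p => hLs p.1 p.2
  -- power and CRLB descent in the direction `d`, read off the constraints of the max–min problem
  have hp : ∀ d τ, (∀ j, (S.commProblem ε).con j (zs.f, S.minSinr zs.f) = 0 →
      fderiv ℝ ((S.commProblem ε).con j) (zs.f, S.minSinr zs.f) (d, τ) < 0) →
      (∀ m, power zs.f m = S.P → powerSlope zs.f d m < 0) ∧
      (S.crlb (S.illum zs.f) = ε → S.crlbSlope (S.illum zs.f) (S.illumSlope zs.f d) < 0) := by
    intro d τ hd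
    refine ⟨fun m hm => ?_, fun hc => ?_⟩
    · rw [← fderiv_con_power S ε zs.f d (S.minSinr zs.f) τ m]
      exact hd (Sum.inr (Sum.inl m)) (sub_eq_zero.2 hm)
    · rw [← fderiv_con_crlb S ε zs.f d (S.minSinr zs.f) τ hpd ()]
      exact hd (Sum.inr (Sum.inr ())) (sub_eq_zero.2 hc)
  have hmin : S.minSinr zs.f = L := by
    obtain ⟨⟨d, τ⟩, hd⟩ := hreg
    by_contra hne
    refine h.not_exists_direction hσ hL hf hρ hu hz (hp d τ hd).1 (hp d τ hd).2
      fun m k hmk => ?_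
    exact absurd (hmk ▸ minSinr_le zs.f m k) (not_le.2 (lt_of_le_of_ne hLmin (Ne.symm hne)))
  refine ⟨?_, hmin⟩
  by_contra hkkt
  have hfeas : (S.commProblem ε).Feasible (zs.f, S.minSinr zs.f) := by
    refine ⟨hpd, ?_⟩
    rintro (p | m | o)
    · exact sub_nonpos.2 (minSinr_le zs.f p.1 p.2)
    · exact sub_nonpos.2 (hi.feasible.1 m)
    · exact sub_nonpos.2 hi.feasible.2.2
  have hdiff : ∀ j, DifferentiableAt ℝ ((S.commProblem ε).con j) (zs.f, S.minSinr zs.f) := by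
    rintro (p | m | o)
    · exact S.differentiableAt_con_sinr ε _ _ hσ p
    · exact S.differentiableAt_con_power ε _ _ m
    · exact S.differentiableAt_con_crlb ε _ _ hpd o
  obtain ⟨⟨d, τ⟩, hτ, hd⟩ := MaxProblem.exists_ascent_of_not_isKKT hfeas
    (S.differentiableAt_obj ε _ _) hdiff hreg hkkt
  rw [fderiv_obj] at hτ
  refine h.not_exists_direction hσ hL hf hρ hu hz (hp d τ hd).1 (hp d τ hd).2 fun m k hmk => ?_
  have hs := hd (Sum.inl (m, k)) (sub_eq_zero.2 (hmin.trans hmk.symm))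
  rw [fderiv_con_sinr S ε zs.f d _ τ hσ (m, k)] at hs
  linarith

end Run

end ISACSystem

namespace ISACSystem

variable {M K Nt N : ℕ} {S : ISACSystem M K Nt N} {ε : ℝ} {f : Beams M K Nt}

/-! ### Thresholds at which the constraint qualification can fail -/

/-- The SINR constraints play no role for regularity: the variable `t` may decrease fast. -/
theorem isRegular_of_direction (hσ : 0 < S.σn) (hpd : (S.fisher (S.illum f)).PosDef)
    {d : Beams M K Nt} (hpow : ∀ m, power f m = S.P → powerSlope f d m < 0)
    (hcrlb : S.crlb (S.illum f) = ε → S.crlbSlope (S.illum f) (S.illumSlope f d) < 0) :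
    S.IsRegular ε f := by
  refine ⟨(d, -1 - ∑ p : Fin M × Fin K, |S.sinrSlope f d p.1 p.2|), ?_⟩
  rintro (p | m | o) hj
  · rw [fderiv_con_sinr S ε f d _ _ hσ p]
    have h1 := Finset.single_le_sum (f := fun p : Fin M × Fin K => |S.sinrSlope f d p.1 p.2|)
      (fun _ _ => abs_nonneg _) (Finset.mem_univ p)
    have h2 := neg_abs_le (S.sinrSlope f d p.1 p.2)
    linarith
  · rw [fderiv_con_power S ε f d _ _ m]
    exact hpow m (sub_eq_zero.1 hj)
  · rw [fderiv_con_crlb S ε f d _ _ hpd o]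
    exact hcrlb (sub_eq_zero.1 hj)

theorem illum_le (f : Beams M K Nt) (m : Fin M) :
    S.illum f m ≤ ‖S.steer m‖ ^ 2 * power f m := by
  rw [illum, power, Finset.mul_sum]
  refine Finset.sum_le_sum fun k _ => ?_
  rw [tx_eq_inner, ← mul_pow]
  gcongr
  exact norm_inner_le_norm _ _

theorem power_nonneg (f : Beams M K Nt) (m : Fin M) : 0 ≤ power f m :=
  Finset.sum_nonneg fun _ _ => sq_nonneg _

theorem Feasible.P_pos (h : S.Feasible ε f) : 0 < S.P := by
  by_contra hP
  have h0 := h.2.1.diag_pos (i := 0)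
  rw [fisher_apply, fisherForm_apply] at h0
  refine h0.ne' (Finset.sum_eq_zero fun p _ => ?_)
  have h1 : power f p.1 = 0 :=
    le_antisymm ((h.1 p.1).trans (not_lt.1 hP)) (power_nonneg f p.1)
  have h2 := S.illum_le f p.1
  rw [h1, mul_zero] at h2
  rw [le_antisymm h2 (S.illum_nonneg f p.1), mul_zero]

theorem powerSlope_sub_smul_self (f d : Beams M K Nt) (δ : ℝ) (m : Fin M) :
    powerSlope f (d - δ • f) m = powerSlope f d m - δ * (2 * power f m) := by
  simp only [powerSlope, power, Finset.mul_sum, ← Finset.sum_sub_distrib]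
  refine Finset.sum_congr rfl fun k _ => ?_
  have h1 : (d - δ • f) m k = d m k - (δ : ℂ) • f m k := by
    rw [Complex.coe_smul]; rfl
  have h2 : (inner ℂ (f m k) (f m k)).re = ‖f m k‖ ^ 2 := by
    rw [inner_self_eq_norm_sq_to_K]; norm_cast
  rw [h1, inner_sub_left, inner_smul_left, Complex.conj_ofReal, Complex.sub_re,
    Complex.re_ofReal_mul, h2]
  ring

theorem illumSlope_sub_smul_self (f d : Beams M K Nt) (δ : ℝ) :
    S.illumSlope f (d - δ • f) = S.illumSlope f d - δ • ((2 : ℝ) • S.illum f) := by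
  funext m
  rw [Pi.sub_apply, Pi.smul_apply, Pi.smul_apply, smul_eq_mul, smul_eq_mul, illumSlope,
    illumSlope, illum, Finset.mul_sum, Finset.mul_sum, ← Finset.sum_sub_distrib]
  refine Finset.sum_congr rfl fun k _ => ?_
  have h1 : (d - δ • f) m k = d m k + (-δ) • f m k := by
    rw [neg_smul, ← sub_eq_add_neg]; rfl
  have h2 : (star (S.tx m (f m k)) * S.tx m (f m k)).re = ‖S.tx m (f m k)‖ ^ 2 := by
    have := two_mul_re_star_mul_self_sub (S.tx m (f m k))
    linarith
  have h3 : star (S.tx m (d m k) + (-δ) • S.tx m (f m k)) * S.tx m (f m k) =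
      star (S.tx m (d m k)) * S.tx m (f m k) -
        (δ : ℂ) * (star (S.tx m (f m k)) * S.tx m (f m k)) := by
    simp
    ring
  rw [h1, tx_add_smul, h3, Complex.sub_re, Complex.re_ofReal_mul, h2]
  ring

theorem crlbSlope_sub_smul (q e e' : Fin M → ℝ) (c : ℝ) :
    S.crlbSlope q (e - c • e') = S.crlbSlope q e - c * S.crlbSlope q e' := by
  simp only [crlbSlope, Pi.sub_apply, Pi.smul_apply, smul_eq_mul, sub_mul,
    Finset.sum_sub_distrib, mul_assoc, ← Finset.mul_sum]
  ring

/-- A direction that improves the bound to first order and increases no exhausted transmit power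
suffices for regularity: subtract a small multiple of `f` from it. -/
theorem Feasible.isRegular_of_nonstrict (hσ : 0 < S.σn) (h : S.Feasible ε f) {d : Beams M K Nt}
    (hpow : ∀ m, power f m = S.P → powerSlope f d m ≤ 0)
    (hcrlb : S.crlb (S.illum f) = ε → S.crlbSlope (S.illum f) (S.illumSlope f d) < 0) :
    S.IsRegular ε f := by
  obtain ⟨δ, hδ, hlt⟩ : ∃ δ : ℝ, 0 < δ ∧ (S.crlb (S.illum f) = ε →
      S.crlbSlope (S.illum f) (S.illumSlope f (d - δ • f)) < 0) := by
    by_cases heq : S.crlb (S.illum f) = ε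
    · have hc : Continuous fun δ : ℝ => S.crlbSlope (S.illum f) (S.illumSlope f d) -
          δ * S.crlbSlope (S.illum f) ((2 : ℝ) • S.illum f) := by fun_prop
      have hev := (hc.tendsto 0).eventually_lt_const (u := 0) (by simpa using hcrlb heq)
      obtain ⟨δ, h1, h2⟩ := ((hev.filter_mono nhdsWithin_le_nhds).and
        (self_mem_nhdsWithin : Set.Ioi (0 : ℝ) ∈ 𝓝[>] 0)).exists
      refine ⟨δ, h2, fun _ => ?_⟩
      rw [illumSlope_sub_smul_self, crlbSlope_sub_smul]
      exact h1
    · exact ⟨1, one_pos, fun h' => absurd h' heq⟩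
  refine isRegular_of_direction hσ h.2.1 (d := d - δ • f) (fun m hm => ?_) hlt
  rw [powerSlope_sub_smul_self, hm]
  have := mul_pos hδ (mul_pos two_pos h.P_pos)
  linarith [hpow m hm]

theorem Feasible.isRegular_of_crlb_ne (hσ : 0 < S.σn) (h : S.Feasible ε f)
    (hne : S.crlb (S.illum f) ≠ ε) : S.IsRegular ε f :=
  h.isRegular_of_nonstrict hσ (d := 0) (fun m _ => by simp [powerSlope])
    fun heq => absurd heq hne

/-- The direction that turns the beamformers of base station `m₀` towards its conjugate steering
vector, balanced so as not to increase an exhausted transmit power. -/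
def steerDirection (S : ISACSystem M K Nt N) (f : Beams M K Nt) (m₀ : Fin M) : Beams M K Nt :=
  fun m k => if m = m₀ then
    ((S.P : ℂ) * S.tx m₀ (f m₀ k)) • S.steer m₀ - (S.illum f m₀ : ℂ) • f m₀ k else 0

theorem illumSlope_steerDirection_self (f : Beams M K Nt) (m₀ : Fin M) :
    S.illumSlope f (S.steerDirection f m₀) m₀ =
      2 * (‖S.steer m₀‖ ^ 2 * S.P - S.illum f m₀) * S.illum f m₀ := by
  rw [illumSlope]
  conv_rhs => rw [mul_comm, illum, Finset.sum_mul]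
  refine Finset.sum_congr rfl fun k _ => ?_
  have h1 : S.tx m₀ (S.steerDirection f m₀ m₀ k) =
      ((‖S.steer m₀‖ ^ 2 * S.P - S.illum f m₀ : ℝ) : ℂ) * S.tx m₀ (f m₀ k) := by
    rw [steerDirection, if_pos rfl, tx_eq_inner, inner_sub_right, inner_smul_right,
      inner_smul_right, inner_self_eq_norm_sq_to_K, ← tx_eq_inner]
    push_cast
    simp only [Complex.coe_algebraMap]
    ring
  have h2 : (star (S.tx m₀ (f m₀ k)) * S.tx m₀ (f m₀ k)).re = ‖S.tx m₀ (f m₀ k)‖ ^ 2 := by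
    have := two_mul_re_star_mul_self_sub (S.tx m₀ (f m₀ k))
    linarith
  rw [h1, star_mul', Complex.star_def, Complex.conj_ofReal, mul_assoc, Complex.re_ofReal_mul,
    ← Complex.star_def, h2]
  simp only [illum]
  ring

theorem powerSlope_steerDirection_self (f : Beams M K Nt) (m₀ : Fin M) :
    powerSlope f (S.steerDirection f m₀) m₀ = 2 * S.illum f m₀ * (S.P - power f m₀) := by
  have h0 : 2 * S.illum f m₀ * (S.P - power f m₀) =
      ∑ k, 2 * (S.P * ‖S.tx m₀ (f m₀ k)‖ ^ 2 - S.illum f m₀ * ‖f m₀ k‖ ^ 2) := by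
    rw [← Finset.mul_sum, Finset.sum_sub_distrib, ← Finset.mul_sum, ← Finset.mul_sum]
    simp only [illum, power]
    ring
  rw [h0, powerSlope]
  refine Finset.sum_congr rfl fun k _ => ?_
  have h2 : (star (S.tx m₀ (f m₀ k)) * S.tx m₀ (f m₀ k)).re = ‖S.tx m₀ (f m₀ k)‖ ^ 2 := by
    have := two_mul_re_star_mul_self_sub (S.tx m₀ (f m₀ k))
    linarith
  have h3 : (inner ℂ (f m₀ k) (f m₀ k)).re = ‖f m₀ k‖ ^ 2 := by
    rw [inner_self_eq_norm_sq_to_K]; norm_cast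
  rw [steerDirection, if_pos rfl, inner_sub_left, inner_smul_left, inner_smul_left, map_mul,
    Complex.conj_ofReal, Complex.conj_ofReal, ← tx_eq_inner, mul_assoc, Complex.sub_re,
    Complex.re_ofReal_mul, Complex.re_ofReal_mul, h3, ← Complex.star_def, h2]

/-- A feasible point is regular unless every base station that matters for the Cramér–Rao bound
illuminates the target either not at all or as strongly as its power budget permits. -/
theorem Feasible.isRegular_of_illum (hσ : 0 < S.σn) (h : S.Feasible ε f) {p : Fin M × Fin N}
    (hw : 0 < S.weight p) (hcol : S.Lam 0 p ≠ 0 ∨ S.Lam 1 p ≠ 0) (h0 : S.illum f p.1 ≠ 0)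
    (hmax : S.illum f p.1 ≠ ‖S.steer p.1‖ ^ 2 * S.P) : S.IsRegular ε f := by
  have hpos : 0 < S.illum f p.1 := (S.illum_nonneg f p.1).lt_of_ne' h0
  have hlt : S.illum f p.1 < ‖S.steer p.1‖ ^ 2 * S.P := lt_of_le_of_ne
    ((S.illum_le f p.1).trans (mul_le_mul_of_nonneg_left (h.1 p.1) (sq_nonneg _))) hmax
  have hslope : 0 < S.illumSlope f (S.steerDirection f p.1) p.1 := by
    rw [illumSlope_steerDirection_self]
    exact mul_pos (mul_pos two_pos (sub_pos.2 hlt)) hpos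
  refine h.isRegular_of_nonstrict hσ (d := S.steerDirection f p.1) (fun m hm => ?_) fun _ =>
    crlbSlope_neg h.weight_nonneg h.2.1 (fun m => ?_) hslope hw hcol
  · by_cases hmp : m = p.1
    · subst hmp
      rw [powerSlope_steerDirection_self, hm, sub_self, mul_zero]
    · simp [powerSlope, steerDirection, hmp]
  · by_cases hmp : m = p.1
    · subst hmp
      exact hslope.le
    · have hz : S.tx m 0 = 0 := by rw [tx_eq_inner, inner_zero_right]
      simp [illumSlope, steerDirection, hmp, hz]

/-- The thresholds that admit an irregular feasible point are among the finitely many values of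
the Cramér–Rao bound at illuminations that are zero or maximal for each base station. -/
theorem finite_setOf_not_isRegular (hσ : 0 < S.σn) :
    {ε : ℝ | ∃ f : Beams M K Nt, S.Feasible ε f ∧ ¬ S.IsRegular ε f}.Finite := by
  classical
  have hfin : (Set.univ.pi fun m : Fin M => ({0, ‖S.steer m‖ ^ 2 * S.P} : Set ℝ)).Finite :=
    Set.Finite.pi fun m => Set.toFinite _
  refine (hfin.image S.crlb).subset ?_
  rintro ε ⟨f, hf, hreg⟩
  have heq : S.crlb (S.illum f) = ε := by
    by_contra hne
    exact hreg (hf.isRegular_of_crlb_ne hσ hne)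
  set q : Fin M → ℝ := fun m =>
    if S.illum f m = ‖S.steer m‖ ^ 2 * S.P then S.illum f m else 0 with hq
  refine ⟨q, fun m _ => ?_, ?_⟩
  · by_cases hm : S.illum f m = ‖S.steer m‖ ^ 2 * S.P
    · exact Or.inr (by simp [hq, hm])
    · exact Or.inl (by simp [hq, hm])
  · -- `q` and the illumination differ only where they do not contribute to the Fisher matrix
    have hform : ∀ i j, S.fisherForm i j q = S.fisherForm i j (S.illum f) := by
      intro i j
      simp only [fisherForm_apply]
      refine Finset.sum_congr rfl fun p _ => ?_
      by_cases hm : S.illum f p.1 = ‖S.steer p.1‖ ^ 2 * S.P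
      · simp [hq, hm]
      by_cases h0 : S.illum f p.1 = 0
      · simp [hq, h0]
      rcases (hf.weight_nonneg p).eq_or_lt with hw | hw
      · simp [← hw]
      by_cases hcol : S.Lam 0 p ≠ 0 ∨ S.Lam 1 p ≠ 0
      · exact absurd (hf.isRegular_of_illum hσ hw hcol h0 hm) hreg
      · push Not at hcol
        have hz : ∀ i, S.Lam i p = 0 := by
          intro i
          fin_cases i
          exacts [hcol.1, hcol.2]
        simp [hz]
    rw [← heq, crlb_eq, crlb_eq]
    simp only [fisherTr, fisherDet, hform]

end ISACSystem

end

theorem corollary3 {M K Nt N : ℕ} (S : ISACSystem M K Nt N) (hσ : 0 < S.σn) :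
    -- the algorithm is well defined: it can be run from every admissible initial state
    (∀ (ε : ℝ) (z₀ : SCAState M K Nt), S.IsInitial ε z₀ →
      ∃ z q ϖ, S.IsRun ε z q ϖ ∧ z 0 = z₀) ∧
    -- convergence of every run
    (∀ (ε : ℝ) (z : ℕ → SCAState M K Nt) (q : ℕ → Fin M → ℝ) (ϖ : ℕ → ℝ),
      S.IsRun ε z q ϖ →
      Monotone ϖ ∧
      Bornology.IsBounded (Set.range fun r => (z r).f) ∧
      (∃ fs, ISACSystem.IsAccumulationPoint z fs) ∧
      (∃ L : ℝ, Tendsto ϖ atTop (𝓝 L) ∧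
        ∀ fs, ISACSystem.IsAccumulationPoint z fs → S.IsRegular ε fs →
          S.IsKKTPoint ε fs ∧ S.minSinr fs = L) ∧
      ((∀ fs, ISACSystem.IsAccumulationPoint z fs → S.IsRegular ε fs) →
        Tendsto (fun r => Metric.infDist (z r).f {fs | S.IsKKTPoint ε fs}) atTop (𝓝 0))) ∧
    -- the constraint qualification can fail for finitely many CRLB thresholds only
    {ε : ℝ | ∃ f, S.Feasible ε f ∧ ¬ S.IsRegular ε f}.Finite := by
  refine ⟨fun ε z₀ hz => ISACSystem.exists_isRun hσ hz, fun ε z q ϖ h => ?_,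
    ISACSystem.finite_setOf_not_isRegular hσ⟩
  obtain ⟨L, hL⟩ := h.exists_tendsto hσ
  exact ⟨h.monotone hσ, h.isBounded hσ, h.exists_accumulationPoint hσ,
    ⟨L, hL, fun fs hfs hreg => h.isKKTPoint hσ hL hfs hreg⟩,
    fun hreg => tendsto_infDist_of_mapClusterPt_mem (h.isBounded hσ) fun fs hfs =>
      (h.isKKTPoint hσ hL hfs (hreg fs hfs)).1⟩
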